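/- For a positive Borel measure $\mu$ on $\mathbb C$ and a measurable $h:\mathbb C\to[-\infty,+\infty]$, the integral $\int h\,d\mu=\int h^+d\mu-\int h^-d\mu\in[-\infty,+\infty]$ is called well defined if $\int h^+d\mu$ and $\int h^-d\mu$ are not both infinite. Given a class $H$ of functions $h:\mathbb C\to[-\infty,+\infty]$, a measure $\omega$ is called an $H$-balayage of a measure $\delta$ if for each $h\in H$ both integrals $\int h\,d\delta$ and $\int h\,d\omega$ are well defined and $\int h\,d\delta\le\int h\,d\omega$. For $p\in[0,+\infty]$ let $$\mathsf{mon}_p=\{z\mapsto \operatorname{Re}(cz^k): c\in\mathbb C,\ k\in\mathbb N_0,\ k\le p\},\qquad \mathsf{lnmon}_p=\mathsf{mon}_p\cup\{z\mapsto\ln|z-w|: w\in\mathbb C\},$$ where $\ln 0=-\infty$. Let $\mathsf{har}$ be the class of harmonic functions on $\mathbb C$ and $\mathsf{sbh}$ the class of subharmonic functions on $\mathbb C$ (the constant $-\infty$ included). **Proposition.** Let $p\in[0,+\infty)$ and let $\delta,\omega$ be positive Borel measures on $\mathbb C$ with $0<\delta(\mathbb C)<+\infty$ and $0<\omega(\mathbb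 C)<+\infty$. 1. If $p<1$, then $\omega$ is a $\mathsf{mon}_p$-balayage of $\delta$ if and only if $\omega(\mathbb C)=\delta(\mathbb C)$. 2. Suppose that $\int|z|^{\lfloor p\rfloor}d\delta(z)<+\infty$ or $\int|z|^{\lfloor p\rfloor}d\omega(z)<+\infty$. Then the following three statements are equivalent: (i) $\omega$ is a $\mathsf{mon}_p$-balayage of $\delta$; (ii) for each integer $0\le k\le p$, the function $z^k$ is integrable with respect to $\delta$ and $\omega$, and $\int z^k\,d\delta(z)=\int z^k\,d\omega(z)$; (iii) each complex polynomial $P$ of degree at most $p$ is integrable with respect to $\delta$ and $\omega$, and $\int P\,d\delta=\int P\,d\omega$. 3. If $$\int_1^{+\infty}\frac{\omega(\mathbb C)-\omega(\{z:|z|\le t\})}{t}\,t^{\lfloor p\rfloor}\,dt<+\infty,$$ then for each $h\in\mathsf{lnmon}_p$ the integral $\int h\,d\omega$ is well defined, with a value in $\mathbb R\cup\{-\infty\}$. Suppose in addition that $\delta$ and $\omega$ have compact supports. 4. If $\omega$ is a $\mathsf{mon}_\infty$-balayage of $\delta$, then $\omega$ is a $\mathsf{har}$-balayage of $\delta$.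 5. If $\omega$ is a $\mathsf{lnmon}_\infty$-balayage of $\delta$, then $\omega$ is a $\mathsf{sbh}$-balayage of $\delta$. -/

import Mathlib

open MeasureTheory

noncomputable section

/-- The integral of an extended real function, `∫ h⁺ dμ - ∫ h⁻ dμ`; it is meaningful when
`HasExtIntegral μ h` holds. -/
def extIntegral {α : Type*} [MeasurableSpace α] (μ : Measure α) (h : α → EReal) : EReal :=
  ((∫⁻ x, (h x).toENNReal ∂μ : ENNReal) : EReal) -
    ((∫⁻ x, (-h x).toENNReal ∂μ : ENNReal) : EReal)

/-- The integral of `h` is well defined with a value in `[-∞, +∞]`: `h` is measurable and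
`∫ h⁺ dμ`, `∫ h⁻ dμ` are not both infinite. -/
def HasExtIntegral {α : Type*} [MeasurableSpace α] (μ : Measure α) (h : α → EReal) : Prop :=
  AEMeasurable h μ ∧
    (∫⁻ x, (h x).toENNReal ∂μ ≠ ⊤ ∨ ∫⁻ x, (-h x).toENNReal ∂μ ≠ ⊤)

/-- `ω` is a balayage of `δ` with respect to the class `H` of extended real functions. -/
def IsBalayage (H : Set (ℂ → EReal)) (δ ω : Measure ℂ) : Prop :=
  ∀ h ∈ H, HasExtIntegral δ h ∧ HasExtIntegral ω h ∧ extIntegral δ h ≤ extIntegral ω h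

/-- The complex monomials `z ↦ c z ^ k` of degree `k ≤ p`. -/
def complexMonomials (p : EReal) : Set (ℂ → ℂ) :=
  {f | ∃ (k : ℕ) (c : ℂ), (k : EReal) ≤ p ∧ f = fun z => c * z ^ k}

/-- The class `mon_p` of real parts of complex monomials of degree at most `p`. -/
def monClass (p : EReal) : Set (ℂ → EReal) :=
  {h | ∃ f ∈ complexMonomials p, h = fun z => ((f z).re : EReal)}

/-- The functions `z ↦ ln |z - w|`, `w ∈ ℂ`, with the value `-∞` at `z = w`. -/
def lnClass : Set (ℂ → EReal) :=
  {h | ∃ w : ℂ, h = fun z => ENNReal.log ‖z - w‖ₑ}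

/-- The class `lnmon_p`. -/
def lnmonClass (p : EReal) : Set (ℂ → EReal) := lnClass ∪ monClass p

/-- The class of harmonic functions on `ℂ`. -/
def harClass : Set (ℂ → EReal) :=
  {h | ∃ u : ℂ → ℝ, InnerProductSpace.HarmonicOnNhd u Set.univ ∧ h = fun z => (u z : EReal)}

/-- The mean value of `u` over the circle with centre `z` and radius `r`. -/
def circleMean (u : ℂ → EReal) (z : ℂ) (r : ℝ) : EReal :=
  extIntegral (ENNReal.ofReal (2 * Real.pi)⁻¹ • volume.restrict (Set.Ioc 0 (2 * Real.pi)))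
    (fun θ : ℝ => u (circleMap z r θ))

/-- Subharmonic functions on `ℂ`: upper semicontinuous functions with values in `[-∞, +∞)`
which satisfy the sub-mean value inequality on circles (`-∞` is allowed as a constant). -/
def IsSubharmonic (u : ℂ → EReal) : Prop :=
  (∀ z, u z < ⊤) ∧ UpperSemicontinuous u ∧ ∀ (z : ℂ) (r : ℝ), 0 < r → u z ≤ circleMean u z r

/-- The class of subharmonic functions on `ℂ`. -/
def sbhClass : Set (ℂ → EReal) := {u | IsSubharmonic u}

/-- `N⋆_ν(r, R; f)`, the integral of `(ν(ℂ) - ν({|z| ≤ t})) f(t) / t` over `r < t < R`,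
for a finite measure `ν`. -/
def starN (ν : Measure ℂ) (r : ℝ) (R : EReal) (f : ℝ → ℝ) : EReal :=
  extIntegral (volume.restrict {t : ℝ | r < t ∧ (t : EReal) < R})
    (fun t => (((ν.real Set.univ - ν.real (Metric.closedBall 0 t)) / t * f t : ℝ) : EReal))

end

/-!
The integral of an integrable real function in the extended sense is its Bochner integral, and a
class of functions that is stable under `f ↦ -f` turns the balayage inequality into an equality
(`IsBalayage.integral_eq`). This settles the statements on moments. The existence of the integrals
is the layer cake formula: `starN ω 1 ⊤ (t ↦ t ^ n)` is the integral of a primitive of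
`t ^ n / t` along `‖z‖`, which dominates both `log⁺ ‖z‖` and `‖z‖ ^ n` up to constants.

For measures in a disc, a holomorphic function near that disc is the sum of its Taylor series, so
equality of all moments gives equality of its integrals. Applied to a holomorphic function with a
given harmonic real part, this is the statement on harmonic functions; applied to
`log (1 - z / w)`, it shows that the logarithmic potentials of `δ` and `ω` agree far out.

The statement on subharmonic functions is obtained without the Riesz decomposition. The mean of
`log |x - w|` over the circle `|x - z| = r` exceeds `log |z - w|` by `K_r(z - w)`, where
`K_r(x) = log⁺ (r / |x|)` is nonnegative, radial and supported in `|x| ≤ r`. Let `q ≥ 0` be the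
potential of `ω` minus that of `δ`; it vanishes off a disc. For a locally bounded subharmonic `v`
with circle means `M_r v`, moving the averaging from `v` to `q` by Fubini gives
`∫ (v * K_r) dω - ∫ (v * K_r) dδ = ∫ (M_r v - v) q dA ≥ 0`
(`integral_conv_circleLogKernel_le`). After division by `∫ K_r`, the functions `v * K_r` converge
to `v` pointwise and boundedly as `r → 0`: they are at least `v` by the sub-mean value inequality
and their upper limit is at most `v` by upper semicontinuity. Hence `∫ v dδ ≤ ∫ v dω`
(`integral_le_of_logPotential_le`). A general subharmonic `u` is the decreasing limit of the
truncations `max u (-N)`, and monotone convergence concludes.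
-/

/-! ### The extended integral -/

section ExtIntegral

variable {α : Type*} [MeasurableSpace α] {μ : Measure α}

theorem extIntegral_mono_ae {g h : α → EReal} (hgh : g ≤ᵐ[μ] h) :
    extIntegral μ g ≤ extIntegral μ h := by
  unfold extIntegral
  apply EReal.sub_le_sub
  · rw [EReal.coe_ennreal_le_coe_ennreal_iff]
    exact lintegral_mono_ae (hgh.mono fun x hx => EReal.toENNReal_le_toENNReal hx)
  · rw [EReal.coe_ennreal_le_coe_ennreal_iff]
    exact lintegral_mono_ae (hgh.mono fun x hx =>
      EReal.toENNReal_le_toENNReal (EReal.neg_le_neg_iff.2 hx))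

theorem extIntegral_congr_ae {g h : α → EReal} (hgh : g =ᵐ[μ] h) :
    extIntegral μ g = extIntegral μ h :=
  le_antisymm (extIntegral_mono_ae hgh.le) (extIntegral_mono_ae hgh.symm.le)

theorem hasExtIntegral_coe {f : α → ℝ} (hf : Integrable f μ) :
    HasExtIntegral μ (fun x => (f x : EReal)) := by
  refine ⟨hf.aemeasurable.coe_real_ereal, Or.inl ?_⟩
  simpa using hf.lintegral_lt_top.ne

theorem extIntegral_coe {f : α → ℝ} (hf : Integrable f μ) :
    extIntegral μ (fun x => (f x : EReal)) = ((∫ x, f x ∂μ : ℝ) : EReal) := by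
  unfold extIntegral
  have h1 := hf.lintegral_lt_top.ne
  have h2 := hf.neg.lintegral_lt_top.ne
  simp only [Pi.neg_apply] at h2
  rw [integral_eq_lintegral_pos_part_sub_lintegral_neg_part hf, EReal.coe_sub,
    ← EReal.coe_ennreal_toReal, ← EReal.coe_ennreal_toReal]
  · simp [← EReal.coe_neg]
  · simpa [← EReal.coe_neg] using h2
  · simpa using h1

theorem extIntegral_neg {h : α → EReal} (hh : HasExtIntegral μ h) :
    extIntegral μ (fun x => -h x) = -extIntegral μ h := by
  unfold extIntegral
  simp only [neg_neg]
  rw [EReal.neg_sub]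
  · rw [add_comm, sub_eq_add_neg]
  · simp
  · rcases hh.2 with h' | h' <;> simp [h']

/-- A real function whose extended integral is well defined and finite is integrable. -/
theorem integrable_of_extIntegral_eq_coe {f : α → ℝ} {a : ℝ}
    (hf : HasExtIntegral μ (fun x => (f x : EReal)))
    (ha : extIntegral μ (fun x => (f x : EReal)) = a) : Integrable f μ := by
  have hm : AEMeasurable f μ := by
    simpa using hf.1.ereal_toReal
  unfold extIntegral at ha
  rw [← integrable_norm_iff hm.aestronglyMeasurable]
  refine ⟨hm.norm.aestronglyMeasurable, ?_⟩
  have hp : ∫⁻ x, ((f x : EReal)).toENNReal ∂μ ≠ ⊤ := by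
    intro h
    rw [h] at ha
    have := hf.2.resolve_left (not_not_intro h)
    lift ∫⁻ x, (-(f x : EReal)).toENNReal ∂μ to NNReal using this with b
    simp at ha
  have hn : ∫⁻ x, (-(f x : EReal)).toENNReal ∂μ ≠ ⊤ := by
    intro h
    rw [h] at ha
    simp at ha
  have : ∀ x, ‖‖f x‖‖ₑ = ((f x : EReal)).toENNReal + (-(f x : EReal)).toENNReal := by
    intro x
    rw [← EReal.coe_neg, EReal.real_coe_toENNReal, EReal.real_coe_toENNReal, enorm_norm,
      Real.enorm_eq_ofReal_abs]
    rcases le_total 0 (f x) with h | h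
    · rw [abs_of_nonneg h, ENNReal.ofReal_of_nonpos (neg_nonpos.2 h), add_zero]
    · rw [abs_of_nonpos h, ENNReal.ofReal_of_nonpos h, zero_add]
  unfold HasFiniteIntegral
  simp_rw [this]
  rw [lintegral_add_left' hf.1.ereal_toENNReal]
  exact ENNReal.add_lt_top.2 ⟨hp.lt_top, hn.lt_top⟩

end ExtIntegral

/-- A balayage with respect to a class that contains both `f` and `-f` preserves the integral of
`f`, as soon as one of the two integrals is finite. -/
theorem IsBalayage.integral_eq {H : Set (ℂ → EReal)} {δ ω : Measure ℂ} (hb : IsBalayage H δ ω)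
    {f : ℂ → ℝ} (hf : (fun z => (f z : EReal)) ∈ H) (hf' : (fun z => ((-f z : ℝ) : EReal)) ∈ H)
    (hi : Integrable f δ ∨ Integrable f ω) :
    Integrable f δ ∧ Integrable f ω ∧ ∫ z, f z ∂δ = ∫ z, f z ∂ω := by
  obtain ⟨h1, h2, h3⟩ := hb _ hf
  have h4 := (hb _ hf').2.2
  simp only [EReal.coe_neg] at h4
  rw [extIntegral_neg h1, extIntegral_neg h2, EReal.neg_le_neg_iff] at h4
  have h5 := le_antisymm h3 h4
  have key : Integrable f δ ∧ Integrable f ω := by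
    rcases hi with hi | hi
    · exact ⟨hi, integrable_of_extIntegral_eq_coe h2 (h5 ▸ extIntegral_coe hi)⟩
    · exact ⟨integrable_of_extIntegral_eq_coe h1 (h5.trans (extIntegral_coe hi)), hi⟩
  refine ⟨key.1, key.2, ?_⟩
  rwa [extIntegral_coe key.1, extIntegral_coe key.2, EReal.coe_eq_coe_iff] at h5

/-! ### Balayage and moments -/

theorem integrable_pow_of_le {μ : Measure ℂ} [IsFiniteMeasure μ] {k n : ℕ} (hkn : k ≤ n)
    (hn : Integrable (fun z : ℂ => z ^ n) μ) : Integrable (fun z : ℂ => z ^ k) μ := by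
  refine Integrable.mono' ((integrable_const (1 : ℝ)).add hn.norm)
    (by fun_prop) (Filter.Eventually.of_forall fun z => ?_)
  simp only [norm_pow, Pi.add_apply]
  rcases le_total ‖z‖ 1 with h | h
  · exact (pow_le_one₀ (norm_nonneg _) h).trans (le_add_of_nonneg_right (by positivity))
  · exact (pow_le_pow_right₀ h hkn).trans (le_add_of_nonneg_left zero_le_one)

theorem re_monomial_mem_monClass {p : EReal} {k : ℕ} (hk : (k : EReal) ≤ p) (c : ℂ) :
    (fun z : ℂ => (((c * z ^ k).re : ℝ) : EReal)) ∈ monClass p :=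
  ⟨_, ⟨k, c, hk, rfl⟩, rfl⟩

theorem IsBalayage.moment_eq {p : EReal} {δ ω : Measure ℂ} (hb : IsBalayage (monClass p) δ ω)
    {k : ℕ} (hk : (k : EReal) ≤ p)
    (hi : Integrable (fun z : ℂ => z ^ k) δ ∨ Integrable (fun z : ℂ => z ^ k) ω) :
    Integrable (fun z : ℂ => z ^ k) δ ∧ Integrable (fun z : ℂ => z ^ k) ω ∧
      ∫ z : ℂ, z ^ k ∂δ = ∫ z : ℂ, z ^ k ∂ω := by
  have hre := hb.integral_eq (f := fun z => (z ^ k).re)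
    (by simpa using re_monomial_mem_monClass hk 1)
    (by simpa using re_monomial_mem_monClass hk (-1)) (hi.imp (·.re) (·.re))
  -- `Im (z ^ k) = Re (-i z ^ k)` is again the real part of a monomial
  have him := hb.integral_eq (f := fun z => (z ^ k).im)
    (by simpa using re_monomial_mem_monClass hk (-Complex.I))
    (by simpa using re_monomial_mem_monClass hk Complex.I) (hi.imp (·.im) (·.im))
  have e : (fun z : ℂ => z ^ k) =
      fun z => (((z ^ k).re : ℝ) : ℂ) + (((z ^ k).im : ℝ) : ℂ) * Complex.I :=
    funext fun z => (Complex.re_add_im _).symm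
  have h1 : Integrable (fun z : ℂ => z ^ k) δ := by
    rw [e]; exact hre.1.ofReal.add (him.1.ofReal.mul_const _)
  have h2 : Integrable (fun z : ℂ => z ^ k) ω := by
    rw [e]; exact hre.2.1.ofReal.add (him.2.1.ofReal.mul_const _)
  refine ⟨h1, h2, ?_⟩
  rw [← integral_re_add_im h1, ← integral_re_add_im h2]
  exact congrArg₂ (fun a b : ℝ => (a : ℂ) + (b : ℂ) * Complex.I) hre.2.2 him.2.2

theorem isBalayage_monClass_of_moment_eq {p : EReal} {δ ω : Measure ℂ}
    (h : ∀ k : ℕ, (k : EReal) ≤ p → Integrable (fun z : ℂ => z ^ k) δ ∧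
      Integrable (fun z : ℂ => z ^ k) ω ∧ ∫ z : ℂ, z ^ k ∂δ = ∫ z : ℂ, z ^ k ∂ω) :
    IsBalayage (monClass p) δ ω := by
  rintro _ ⟨_, ⟨k, c, hk, rfl⟩, rfl⟩
  obtain ⟨h1, h2, h3⟩ := h k hk
  have h1' : Integrable (fun z : ℂ => (c * z ^ k).re) δ := (h1.const_mul c).re
  have h2' : Integrable (fun z : ℂ => (c * z ^ k).re) ω := (h2.const_mul c).re
  refine ⟨hasExtIntegral_coe h1', hasExtIntegral_coe h2', ?_⟩
  rw [extIntegral_coe h1', extIntegral_coe h2', EReal.coe_le_coe_iff]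
  have e1 := integral_re (h1.const_mul c)
  have e2 := integral_re (h2.const_mul c)
  simp only [RCLike.re_to_complex] at e1 e2
  rw [e1, e2, integral_const_mul, integral_const_mul, h3]

theorem isBalayage_monClass_iff_measure_univ_eq {p : ℝ} (hp : 0 ≤ p) (hp1 : p < 1)
    {δ ω : Measure ℂ} [IsFiniteMeasure δ] [IsFiniteMeasure ω] :
    IsBalayage (monClass p) δ ω ↔ ω Set.univ = δ Set.univ := by
  constructor
  · intro hb
    have := (hb.moment_eq (k := 0) (by simpa using hp) (Or.inl (by simp))).2.2
    simp only [pow_zero, integral_const, Complex.real_smul, mul_one, Complex.ofReal_inj] at this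
    exact ((measureReal_eq_measureReal_iff).1 this).symm
  · intro h
    apply isBalayage_monClass_of_moment_eq
    intro k hk
    have hk0 : k = 0 := by
      have : (k : ℝ) ≤ p := by exact_mod_cast hk
      exact Nat.lt_one_iff.1 (by exact_mod_cast this.trans_lt hp1)
    subst hk0
    simp [measureReal_def, h]

theorem natCast_le_coe_ereal {k : ℕ} {p : ℝ} : (k : EReal) ≤ (p : EReal) ↔ (k : ℝ) ≤ p := by
  rw [← EReal.coe_natCast, EReal.coe_le_coe_iff]

theorem balayage_moments_polynomials_tfae {p : ℝ} {δ ω : Measure ℂ}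
    [IsFiniteMeasure δ] [IsFiniteMeasure ω]
    (hi : Integrable (fun z : ℂ => z ^ ⌊p⌋₊) δ ∨ Integrable (fun z : ℂ => z ^ ⌊p⌋₊) ω) :
    List.TFAE [
      IsBalayage (monClass p) δ ω,
      ∀ k : ℕ, (k : ℝ) ≤ p →
        Integrable (fun z : ℂ => z ^ k) δ ∧ Integrable (fun z : ℂ => z ^ k) ω ∧
          ∫ z : ℂ, z ^ k ∂δ = ∫ z : ℂ, z ^ k ∂ω,
      ∀ P : Polynomial ℂ, (P.natDegree : ℝ) ≤ p →
        Integrable (fun z : ℂ => P.eval z) δ ∧ Integrable (fun z : ℂ => P.eval z) ω ∧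
          ∫ z : ℂ, P.eval z ∂δ = ∫ z : ℂ, P.eval z ∂ω] := by
  tfae_have 1 → 2 := by
    intro hb k hk
    have hk' := Nat.le_floor hk
    exact hb.moment_eq (natCast_le_coe_ereal.2 hk)
      (hi.imp (integrable_pow_of_le hk') (integrable_pow_of_le hk'))
  tfae_have 2 → 1 := fun h =>
    isBalayage_monClass_of_moment_eq fun k hk => h k (natCast_le_coe_ereal.1 hk)
  tfae_have 2 → 3 := by
    intro h P hP
    have hk : ∀ i ∈ Finset.range (P.natDegree + 1), (i : ℝ) ≤ p := fun i hi =>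
      le_trans (by exact_mod_cast Nat.lt_succ_iff.1 (Finset.mem_range.1 hi)) hP
    simp only [Polynomial.eval_eq_sum_range]
    refine ⟨integrable_finsetSum _ fun i hi => (h i (hk i hi)).1.const_mul _,
      integrable_finsetSum _ fun i hi => (h i (hk i hi)).2.1.const_mul _, ?_⟩
    rw [integral_finsetSum _ fun i hi => (h i (hk i hi)).1.const_mul _,
      integral_finsetSum _ fun i hi => (h i (hk i hi)).2.1.const_mul _]
    refine Finset.sum_congr rfl fun i hi => ?_
    rw [integral_const_mul, integral_const_mul, (h i (hk i hi)).2.2]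
  tfae_have 3 → 2 := by
    intro h k hk
    simpa using h (Polynomial.X ^ k) (by simpa using hk)
  tfae_finish

/-! ### Finiteness of the integrals -/

/-- The density `t ^ n / t` on `t > 1`, the weight of the layer cake formula behind `starN`. -/
noncomputable def powWeight (n : ℕ) : ℝ → ℝ := (Set.Ioi 1).indicator fun t => t ^ n / t

theorem powWeight_nonneg (n : ℕ) (t : ℝ) : 0 ≤ powWeight n t := by
  refine Set.indicator_nonneg (fun t ht => ?_) t
  have : (0 : ℝ) < t := zero_lt_one.trans ht
  positivity

theorem intervalIntegrable_pow_div (n : ℕ) {a b : ℝ} (ha : 0 < a) (hb : 0 < b) :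
    IntervalIntegrable (fun t : ℝ => t ^ n / t) volume a b := by
  refine ContinuousOn.intervalIntegrable ?_
  refine (continuousOn_pow n).div continuousOn_id fun t ht => ?_
  exact ((lt_min ha hb).trans_le ht.1).ne'

theorem intervalIntegrable_powWeight (n : ℕ) {s : ℝ} (hs : 0 < s) :
    IntervalIntegrable (powWeight n) volume 0 s := by
  rw [intervalIntegrable_iff_integrableOn_Ioc_of_le hs.le]
  refine Measure.integrableOn_of_bounded (M := s ^ n) (by simp) ?_ ?_
  · exact (Measurable.indicator (by fun_prop) measurableSet_Ioi).aestronglyMeasurable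
  · refine (ae_restrict_mem measurableSet_Ioc).mono fun t ht => ?_
    rw [Real.norm_of_nonneg (powWeight_nonneg n t)]
    refine Set.indicator_apply_le' (fun h1 : 1 < t => ?_) fun _ => by positivity
    have h0 : 0 < t := ht.1
    calc t ^ n / t ≤ t ^ n := div_le_self (by positivity) h1.le
      _ ≤ s ^ n := pow_le_pow_left₀ h0.le ht.2 n

theorem integral_powWeight (n : ℕ) {s : ℝ} (hs : 1 ≤ s) :
    ∫ t in 0..s, powWeight n t = ∫ t in 1..s, t ^ n / t := by
  have hs0 : (0 : ℝ) < s := zero_lt_one.trans_le hs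
  rw [intervalIntegral.integral_of_le hs0.le, intervalIntegral.integral_of_le hs, powWeight,
    setIntegral_indicator measurableSet_Ioi]
  congr 2
  ext t
  simp only [Set.mem_inter_iff, Set.mem_Ioc, Set.mem_Ioi]
  constructor
  · exact fun h => ⟨h.2, h.1.2⟩
  · exact fun h => ⟨⟨zero_lt_one.trans h.1, h.2⟩, h.1⟩

theorem posLog_le_integral_powWeight (n : ℕ) {s : ℝ} (hs : 0 ≤ s) :
    Real.posLog s ≤ ∫ t in 0..s, powWeight n t := by
  rcases le_total s 1 with h | h
  · rw [(Real.posLog_eq_zero_iff s).2 (by rwa [abs_of_nonneg hs])]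
    exact intervalIntegral.integral_nonneg hs fun t _ => powWeight_nonneg n t
  · have h0 : (0 : ℝ) < s := zero_lt_one.trans_le h
    rw [integral_powWeight n h, Real.posLog_eq_log (by rwa [abs_of_nonneg hs])]
    have : Real.log s = ∫ t in (1 : ℝ)..s, t⁻¹ := by
      rw [integral_inv_of_pos zero_lt_one h0, div_one]
    rw [this]
    refine intervalIntegral.integral_mono_on h ?_
      (intervalIntegrable_pow_div n zero_lt_one h0) fun t ht => ?_
    · simpa using intervalIntegrable_pow_div 0 zero_lt_one h0
    · rw [inv_eq_one_div]
      have : (0 : ℝ) < t := zero_lt_one.trans_le ht.1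
      gcongr
      exact one_le_pow₀ ht.1

theorem pow_le_integral_powWeight (n : ℕ) {s : ℝ} (hs : 0 ≤ s) :
    s ^ n ≤ 1 + n * ∫ t in 0..s, powWeight n t := by
  rcases le_total s 1 with h | h
  · refine (pow_le_one₀ hs h).trans (le_add_of_nonneg_right (mul_nonneg n.cast_nonneg ?_))
    exact intervalIntegral.integral_nonneg hs fun t _ => powWeight_nonneg n t
  · rw [integral_powWeight n h]
    rcases n with _ | m
    · simp
    · have : ∫ t in (1 : ℝ)..s, t ^ (m + 1) / t = ∫ t in (1 : ℝ)..s, t ^ m := by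
        refine intervalIntegral.integral_congr fun t ht => ?_
        rw [Set.uIcc_of_le h] at ht
        have : t ≠ 0 := (zero_lt_one.trans_le ht.1).ne'
        rw [pow_succ, mul_div_cancel_right₀ _ this]
      rw [this, integral_pow]
      push_cast
      field_simp
      simp

/-- By the layer cake formula, finiteness of `starN ω 1 ⊤ (t ↦ t ^ n)` says that a primitive of
`powWeight n` is integrable along `‖z‖`. -/
theorem lintegral_powWeight_lt_top {ω : Measure ℂ} [IsFiniteMeasure ω] {n : ℕ}
    (h : starN ω 1 ⊤ (fun t => t ^ n) < ⊤) :
    ∫⁻ z, ENNReal.ofReal (∫ t in 0..‖z‖, powWeight n t) ∂ω < ⊤ := by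
  rw [lintegral_comp_eq_lintegral_meas_lt_mul ω (Filter.Eventually.of_forall fun z => norm_nonneg z)
    (by fun_prop) (fun t ht => intervalIntegrable_powWeight n ht)
    (Filter.Eventually.of_forall (powWeight_nonneg n))]
  have hset : {t : ℝ | 1 < t ∧ (t : EReal) < ⊤} = Set.Ioi 1 := by
    ext t; simp [EReal.coe_lt_top]
  have hnn : ∀ t : ℝ, 1 < t →
      0 ≤ (ω.real Set.univ - ω.real (Metric.closedBall 0 t)) / t * t ^ n := fun t ht => by
    have h0 : 0 < t := zero_lt_one.trans ht
    have : ω.real (Metric.closedBall 0 t) ≤ ω.real Set.univ := measureReal_mono (Set.subset_univ _)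
    have := sub_nonneg.2 this
    positivity
  unfold starN extIntegral at h
  rw [hset] at h
  have h2 : ∫⁻ t in Set.Ioi (1 : ℝ),
      (-(((ω.real Set.univ - ω.real (Metric.closedBall 0 t)) / t * t ^ n : ℝ) : EReal)).toENNReal
        = 0 := by
    rw [setLIntegral_congr_fun measurableSet_Ioi (g := fun _ => 0) fun t ht => ?_]
    · simp
    · simp only
      rw [EReal.toENNReal_of_nonpos]
      rw [← EReal.coe_neg, ← EReal.coe_zero, EReal.coe_le_coe_iff]
      exact neg_nonpos.2 (hnn t ht)
  rw [h2, EReal.coe_ennreal_zero, sub_zero, lt_top_iff_ne_top, ne_eq,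
    EReal.coe_ennreal_eq_top_iff, ← ne_eq, ← lt_top_iff_ne_top] at h
  refine lt_of_eq_of_lt ?_ h
  rw [← lintegral_indicator measurableSet_Ioi, ← lintegral_indicator measurableSet_Ioi]
  congr 1
  ext t
  by_cases ht : 1 < t
  · have h0 : t ∈ Set.Ioi (0 : ℝ) := zero_lt_one.trans ht
    rw [Set.indicator_of_mem h0, Set.indicator_of_mem (Set.mem_Ioi.2 ht), EReal.real_coe_toENNReal, powWeight,
      Set.indicator_of_mem (Set.mem_Ioi.2 ht)]
    have e : ω {a : ℂ | t < ‖a‖} =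
        ENNReal.ofReal (ω.real Set.univ - ω.real (Metric.closedBall 0 t)) := by
      rw [← measureReal_compl Metric.isClosed_closedBall.measurableSet, ofReal_measureReal]
      congr 1
      ext a
      simp
    rw [e, ← ENNReal.ofReal_mul (sub_nonneg.2 (measureReal_mono (Set.subset_univ _)))]
    congr 1
    ring
  · rw [Set.indicator_of_notMem (s := Set.Ioi (1 : ℝ)) ht]
    simp [Set.indicator_apply, powWeight, ht]

theorem extIntegral_lt_top {α : Type*} [MeasurableSpace α] {μ : Measure α} {h : α → EReal}
    (hh : ∫⁻ x, (h x).toENNReal ∂μ ≠ ⊤) : extIntegral μ h < ⊤ := by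
  unfold extIntegral
  lift ∫⁻ x, (h x).toENNReal ∂μ to NNReal using hh with a
  generalize ∫⁻ x, (-h x).toENNReal ∂μ = b
  rw [sub_eq_add_neg]
  refine EReal.add_lt_top ?_ ?_
  · simp
  · simp

theorem measurable_logKernel (w : ℂ) : Measurable fun z : ℂ => ENNReal.log ‖z - w‖ₑ :=
  ENNReal.measurable_log.comp (by fun_prop)

theorem toENNReal_log_enorm (z : ℂ) :
    (ENNReal.log ‖z‖ₑ).toENNReal = ENNReal.ofReal (Real.posLog ‖z‖) := by
  rw [← ofReal_norm, ENNReal.log_ofReal]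
  split_ifs with h
  · have : ‖z‖ = 0 := le_antisymm h (norm_nonneg z)
    simp [this]
  · simp [Real.posLog, ENNReal.ofReal_max]

theorem hasExtIntegral_lnmonClass {p : ℝ} {ω : Measure ℂ} [IsFiniteMeasure ω]
    (h : starN ω 1 ⊤ (fun t => t ^ ⌊p⌋₊) < ⊤) {u : ℂ → EReal} (hu : u ∈ lnmonClass p) :
    HasExtIntegral ω u ∧ extIntegral ω u < ⊤ := by
  have hfin := lintegral_powWeight_lt_top h
  rcases hu with ⟨w, rfl⟩ | ⟨_, ⟨k, c, hk, rfl⟩, rfl⟩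
  · have key : ∫⁻ z, (ENNReal.log ‖z - w‖ₑ).toENNReal ∂ω ≠ ⊤ := by
      refine ne_top_of_le_ne_top (b := ∫⁻ z, (ENNReal.ofReal (Real.log 2 + Real.posLog ‖w‖) +
        ENNReal.ofReal (∫ t in 0..‖z‖, powWeight ⌊p⌋₊ t)) ∂ω) ?_ (lintegral_mono fun z => ?_)
      · rw [lintegral_add_left measurable_const, lintegral_const]
        exact (ENNReal.add_lt_top.2
          ⟨ENNReal.mul_lt_top ENNReal.ofReal_lt_top (measure_lt_top _ _), hfin⟩).ne
      · rw [toENNReal_log_enorm]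
        refine (ENNReal.ofReal_le_ofReal ?_).trans ENNReal.ofReal_add_le
        have h1 : Real.posLog ‖z - w‖ ≤ Real.posLog (‖z‖ + ‖w‖) :=
          Real.posLog_le_posLog (norm_nonneg _) (norm_sub_le z w)
        have h2 := Real.posLog_add (x := ‖z‖) (y := ‖w‖)
        have h3 := posLog_le_integral_powWeight ⌊p⌋₊ (norm_nonneg z)
        linarith
    exact ⟨⟨(measurable_logKernel w).aemeasurable, Or.inl key⟩, extIntegral_lt_top key⟩
  · have hn : Integrable (fun z : ℂ => z ^ ⌊p⌋₊) ω := by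
      refine ⟨by fun_prop, ?_⟩
      refine lt_of_le_of_lt (b := ∫⁻ z, (1 + ⌊p⌋₊ *
        ENNReal.ofReal (∫ t in 0..‖z‖, powWeight ⌊p⌋₊ t)) ∂ω) (lintegral_mono fun z => ?_) ?_
      · rw [← ofReal_norm, norm_pow]
        refine (ENNReal.ofReal_le_ofReal
          (pow_le_integral_powWeight ⌊p⌋₊ (norm_nonneg z))).trans (ENNReal.ofReal_add_le.trans ?_)
        rw [ENNReal.ofReal_one, ENNReal.ofReal_mul (Nat.cast_nonneg _), ENNReal.ofReal_natCast]
      · rw [lintegral_add_left measurable_const, lintegral_const_mul' _ _ (ENNReal.natCast_ne_top _)]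
        exact ENNReal.add_lt_top.2 ⟨by simp [measure_lt_top],
          ENNReal.mul_lt_top (ENNReal.natCast_lt_top _) hfin⟩
    have hi : Integrable (fun z : ℂ => (c * z ^ k).re) ω :=
      ((integrable_pow_of_le (Nat.le_floor (natCast_le_coe_ereal.1 hk)) hn).const_mul c).re
    refine ⟨hasExtIntegral_coe hi, ?_⟩
    rw [extIntegral_coe hi]
    exact EReal.coe_lt_top _

/-! ### Harmonic functions and measures with compact support -/

theorem integrable_of_continuousOn_of_ae_norm_le {E : Type*} [NormedAddCommGroup E]
    {μ : Measure ℂ} [IsFiniteMeasure μ] {s : ℝ} (hμ : ∀ᵐ z ∂μ, ‖z‖ ≤ s) {F : ℂ → E}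
    (hF : ContinuousOn F (Metric.closedBall 0 s)) : Integrable F μ := by
  have h := hF.integrableOn_compact (μ := μ) (isCompact_closedBall 0 s)
  rwa [IntegrableOn, Measure.restrict_eq_self_of_ae_mem (hμ.mono fun z hz => by simpa using hz)] at h

/-- Integration of the Taylor series of a function holomorphic near the support of `μ`. -/
theorem hasSum_taylor_integral {μ : Measure ℂ} [IsFiniteMeasure μ] {s R : ℝ} (hs : 0 ≤ s)
    (hsR : s < R) (hμ : ∀ᵐ z ∂μ, ‖z‖ ≤ s) {F : ℂ → ℂ}
    (hF : DifferentiableOn ℂ F (Metric.ball 0 R)) :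
    HasSum (fun n : ℕ => (n.factorial : ℂ)⁻¹ * iteratedDeriv n F 0 * ∫ z, z ^ n ∂μ)
      (∫ z, F z ∂μ) := by
  have hsum : ∀ z : ℂ, ‖z‖ ≤ s →
      HasSum (fun n : ℕ => (n.factorial : ℂ)⁻¹ * iteratedDeriv n F 0 * z ^ n) (F z) := by
    intro z hz
    have := Complex.hasSum_taylorSeries_on_ball (c := 0) (z := z) (r := R)
      (by simpa using! hF) (by simpa using! hz.trans_lt hsR)
    refine this.congr_fun fun n => ?_
    simp only [sub_zero, smul_eq_mul]
    ring
  have hint : ∀ n : ℕ, Integrable (fun z : ℂ => z ^ n) μ := fun n =>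
    integrable_of_continuousOn_of_ae_norm_le hμ (by fun_prop)
  have h := hasSum_integral_of_summable_integral_norm (μ := μ)
    (F := fun (n : ℕ) (z : ℂ) => (n.factorial : ℂ)⁻¹ * iteratedDeriv n F 0 * z ^ n)
    (fun n => (hint n).const_mul _) ?_
  · simp_rw [integral_const_mul] at h
    rwa [integral_congr_ae (hμ.mono fun z hz => (hsum z hz).tsum_eq)] at h
  · have h1 := (hsum s (by simp [abs_of_nonneg hs])).summable.norm.mul_left (μ.real Set.univ)
    refine Summable.of_nonneg_of_le (fun n => integral_nonneg fun z => norm_nonneg _)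
      (fun n => ?_) h1
    rw [← smul_eq_mul (α := ℝ), ← integral_const]
    refine integral_mono_ae ((hint n).const_mul _).norm (integrable_const _)
      (hμ.mono fun z hz => ?_)
    simp only [norm_mul, norm_pow, Complex.norm_real, Real.norm_of_nonneg hs]
    gcongr

/-- Measures on a disc with the same moments give the same integral to the real part of a function
holomorphic near that disc. -/
theorem integral_re_eq_of_moment_eq {δ ω : Measure ℂ} [IsFiniteMeasure δ] [IsFiniteMeasure ω]
    {s R : ℝ} (hs : 0 ≤ s) (hsR : s < R) (hδ : ∀ᵐ z ∂δ, ‖z‖ ≤ s) (hω : ∀ᵐ z ∂ω, ‖z‖ ≤ s)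
    (hm : ∀ n : ℕ, ∫ z : ℂ, z ^ n ∂δ = ∫ z : ℂ, z ^ n ∂ω) {F : ℂ → ℂ}
    (hF : DifferentiableOn ℂ F (Metric.ball 0 R)) :
    ∫ z, (F z).re ∂δ = ∫ z, (F z).re ∂ω := by
  have hc : ContinuousOn F (Metric.closedBall 0 s) :=
    hF.continuousOn.mono (Metric.closedBall_subset_ball hsR)
  have e1 := integral_re (integrable_of_continuousOn_of_ae_norm_le hδ hc)
  have e2 := integral_re (integrable_of_continuousOn_of_ae_norm_le hω hc)
  simp only [RCLike.re_to_complex] at e1 e2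
  rw [e1, e2]
  have h1 := hasSum_taylor_integral hs hsR hδ hF
  have h2 := hasSum_taylor_integral hs hsR hω hF
  simp_rw [hm] at h1
  rw [h1.unique h2]

theorem exists_ae_norm_le_of_isCompact_support {δ ω : Measure ℂ} (hδ : IsCompact δ.support)
    (hω : IsCompact ω.support) :
    ∃ s : ℝ, 0 ≤ s ∧ (∀ᵐ z ∂δ, ‖z‖ ≤ s) ∧ ∀ᵐ z ∂ω, ‖z‖ ≤ s := by
  obtain ⟨s, hs⟩ := (hδ.union hω).isBounded.exists_norm_le
  refine ⟨max s 0, le_max_right _ _, ?_, ?_⟩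
  · exact Filter.mem_of_superset Measure.support_mem_ae fun z hz =>
      (hs z (Or.inl hz)).trans (le_max_left _ _)
  · exact Filter.mem_of_superset Measure.support_mem_ae fun z hz =>
      (hs z (Or.inr hz)).trans (le_max_left _ _)

theorem moments_eq_of_isBalayage_top {δ ω : Measure ℂ} [IsFiniteMeasure δ] {s : ℝ}
    (hδ : ∀ᵐ z ∂δ, ‖z‖ ≤ s) (hb : IsBalayage (monClass ⊤) δ ω) (n : ℕ) :
    ∫ z : ℂ, z ^ n ∂δ = ∫ z : ℂ, z ^ n ∂ω :=
  (hb.moment_eq le_top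
    (Or.inl (integrable_of_continuousOn_of_ae_norm_le hδ (by fun_prop)))).2.2

theorem IsBalayage.har_of_mon {δ ω : Measure ℂ} [IsFiniteMeasure δ] [IsFiniteMeasure ω] {s : ℝ}
    (hs : 0 ≤ s) (hδ : ∀ᵐ z ∂δ, ‖z‖ ≤ s) (hω : ∀ᵐ z ∂ω, ‖z‖ ≤ s)
    (hb : IsBalayage (monClass ⊤) δ ω) : IsBalayage harClass δ ω := by
  rintro _ ⟨u, hu, rfl⟩
  obtain ⟨F, hF, rfl⟩ := hu.exists_analyticOnNhd_univ_re_eq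
  have hd : DifferentiableOn ℂ F (Metric.ball 0 (s + 1)) :=
    hF.differentiableOn.mono (Set.subset_univ _)
  have hc : ContinuousOn F (Metric.closedBall 0 s) :=
    hF.continuousOn.mono (Set.subset_univ _)
  have h1 : Integrable (fun z => (F z).re) δ := (integrable_of_continuousOn_of_ae_norm_le hδ hc).re
  have h2 : Integrable (fun z => (F z).re) ω := (integrable_of_continuousOn_of_ae_norm_le hω hc).re
  refine ⟨hasExtIntegral_coe h1, hasExtIntegral_coe h2, ?_⟩
  rw [extIntegral_coe h1, extIntegral_coe h2, integral_re_eq_of_moment_eq hs (lt_add_one s) hδ hω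
    (moments_eq_of_isBalayage_top hδ hb) hd]

/-- The logarithmic potentials of two measures with the same moments agree far out. -/
theorem integral_log_eq_of_moment_eq {δ ω : Measure ℂ} [IsFiniteMeasure δ] [IsFiniteMeasure ω]
    {s : ℝ} (hs : 0 ≤ s) (hδ : ∀ᵐ z ∂δ, ‖z‖ ≤ s) (hω : ∀ᵐ z ∂ω, ‖z‖ ≤ s)
    (hm : ∀ n : ℕ, ∫ z : ℂ, z ^ n ∂δ = ∫ z : ℂ, z ^ n ∂ω) {w : ℂ} (hw : s < ‖w‖) :
    ∫ z, Real.log ‖z - w‖ ∂δ = ∫ z, Real.log ‖z - w‖ ∂ω := by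
  have hw0 : w ≠ 0 := norm_pos_iff.1 (hs.trans_lt hw)
  have hslit : ∀ z ∈ Metric.ball (0 : ℂ) ‖w‖, 1 - z / w ∈ Complex.slitPlane := by
    intro z hz
    left
    have h1 : ‖z / w‖ < 1 := by
      rw [norm_div, div_lt_one (norm_pos_iff.2 hw0)]
      simpa using hz
    have := (Complex.re_le_norm (z / w)).trans_lt h1
    simpa using this
  -- `z ↦ log (-w) + log (1 - z / w)` is a holomorphic logarithm of `z - w` on the disc `|z| < |w|`
  have hre : ∀ z : ℂ, ‖z‖ ≤ s →
      (Complex.log (-w) + Complex.log (1 - z / w)).re = Real.log ‖z - w‖ := by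
    intro z hz
    rw [Complex.add_re, Complex.log_re, Complex.log_re, ← Real.log_mul, ← norm_mul]
    · congr 2
      field_simp
      ring
    · simpa using hw0
    · exact norm_ne_zero_iff.2 (Complex.slitPlane_ne_zero (hslit z (by simpa using hz.trans_lt hw)))
  have hd : DifferentiableOn ℂ (fun z => Complex.log (-w) + Complex.log (1 - z / w))
      (Metric.ball 0 ‖w‖) :=
    (DifferentiableOn.clog (by fun_prop) hslit).const_add _
  have := integral_re_eq_of_moment_eq hs hw hδ hω hm hd
  rwa [integral_congr_ae (hδ.mono hre), integral_congr_ae (hω.mono hre)] at this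

/-! ### The logarithmic kernel -/

theorem integrableOn_log_norm_ball (S : ℝ) :
    IntegrableOn (fun x : ℂ => Real.log ‖x‖) (Metric.ball 0 S) := by
  refine ⟨(Real.measurable_log.comp measurable_norm).aestronglyMeasurable, ?_⟩
  unfold HasFiniteIntegral
  rw [← lintegral_indicator Metric.isOpen_ball.measurableSet,
    ← Complex.lintegral_comp_polarCoord_symm, polarCoord_target]
  -- in polar coordinates the integrand is `t |log t|`, which is bounded on `(0, S)`
  have hb : ∀ t : ℝ, 0 < t → t < S → t * |Real.log t| ≤ 1 + S ^ 2 := by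
    intro t h0 hS
    rcases le_total t 1 with h1 | h1
    · have := Real.abs_log_mul_self_lt t h0 h1
      rw [abs_mul, abs_of_pos h0] at this
      nlinarith [sq_nonneg S]
    · rw [abs_of_nonneg (Real.log_nonneg h1)]
      have := Real.log_le_self h0.le
      nlinarith
  calc _ ≤ ∫⁻ p in Set.Ioi (0 : ℝ) ×ˢ Set.Ioo (-Real.pi) Real.pi,
        (Set.Ioo (0 : ℝ) S ×ˢ Set.Ioo (-Real.pi) Real.pi).indicator
          (fun _ => ENNReal.ofReal (1 + S ^ 2)) p := by
        refine setLIntegral_mono' (measurableSet_Ioi.prod measurableSet_Ioo) fun p hp => ?_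
        have h0 : 0 < p.1 := hp.1
        have hn : ‖Complex.polarCoord.symm p‖ = p.1 := by
          rw [Complex.norm_polarCoord_symm, abs_of_pos h0]
        by_cases hS : p.1 < S
        · have hp' : p ∈ Set.Ioo (0 : ℝ) S ×ˢ Set.Ioo (-Real.pi) Real.pi := ⟨⟨h0, hS⟩, hp.2⟩
          rw [Set.indicator_of_mem (by rwa [mem_ball_zero_iff, hn]),
            Set.indicator_of_mem hp']
          simp only
          rw [hn, Real.enorm_eq_ofReal_abs, smul_eq_mul,
            ← ENNReal.ofReal_mul h0.le]
          exact ENNReal.ofReal_le_ofReal (hb _ h0 hS)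
        · rw [Set.indicator_of_notMem (by rwa [mem_ball_zero_iff, hn])]
          simp
    _ ≤ ∫⁻ p, (Set.Ioo (0 : ℝ) S ×ˢ Set.Ioo (-Real.pi) Real.pi).indicator
          (fun _ => ENNReal.ofReal (1 + S ^ 2)) p := setLIntegral_le_lintegral _ _
    _ < ⊤ := by
        rw [lintegral_indicator (measurableSet_Ioo.prod measurableSet_Ioo), setLIntegral_const,
          Measure.volume_eq_prod, Measure.prod_prod]
        simp only [Real.volume_Ioo]
        finiteness

/-- The kernel `log⁺ (r / |x|)`: the excess over `log |x|` of its mean over circles of radius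
`r`. At `x = 0`, where the true excess is infinite, division by zero gives it the value `0`. -/
noncomputable def circleLogKernel (r : ℝ) (x : ℂ) : ℝ := Real.posLog (r / ‖x‖)

theorem circleLogKernel_nonneg (r : ℝ) (x : ℂ) : 0 ≤ circleLogKernel r x := Real.posLog_nonneg

theorem circleLogKernel_eq_zero {r : ℝ} (hr : 0 < r) {x : ℂ} (hx : r ≤ ‖x‖) :
    circleLogKernel r x = 0 := by
  rw [circleLogKernel, Real.posLog_eq_zero_iff, abs_of_nonneg (by positivity)]
  exact div_le_one_of_le₀ hx (norm_nonneg x)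

@[fun_prop]
theorem measurable_circleLogKernel (r : ℝ) : Measurable (circleLogKernel r) :=
  Real.continuous_posLog.measurable.comp (by fun_prop)

theorem integrable_circleLogKernel {r : ℝ} (hr : 0 < r) : Integrable (circleLogKernel r) := by
  have h : Integrable ((Metric.ball (0 : ℂ) r).indicator
      fun x => |Real.log r| + |Real.log ‖x‖|) := by
    rw [integrable_indicator_iff Metric.isOpen_ball.measurableSet]
    exact (integrableOn_const measure_ball_lt_top.ne).add (integrableOn_log_norm_ball r).abs
  refine h.mono' (by fun_prop) (Filter.Eventually.of_forall fun x => ?_)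
  rw [Real.norm_of_nonneg (circleLogKernel_nonneg r x)]
  by_cases hx : ‖x‖ < r
  · rw [Set.indicator_of_mem (by simpa using hx)]
    rcases eq_or_ne x 0 with rfl | h0
    · simp [circleLogKernel]
    · rw [circleLogKernel, Real.posLog_apply,
        Real.log_div hr.ne' (norm_ne_zero_iff.2 h0)]
      exact max_le (by positivity) ((le_abs_self _).trans (abs_sub _ _))
  · rw [circleLogKernel_eq_zero hr (not_lt.1 hx)]
    exact Set.indicator_nonneg (fun _ _ => by positivity) _

theorem integral_circleLogKernel_pos {r : ℝ} (hr : 0 < r) : 0 < ∫ x, circleLogKernel r x := by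
  rw [integral_pos_iff_support_of_nonneg (circleLogKernel_nonneg r)
    (integrable_circleLogKernel hr)]
  have ho : IsOpen (Metric.ball (0 : ℂ) r \ {0}) := Metric.isOpen_ball.sdiff isClosed_singleton
  have hne : (Metric.ball (0 : ℂ) r \ {0}).Nonempty :=
    ⟨((r / 2 : ℝ) : ℂ), by simp [abs_of_pos hr]; linarith, by simp [hr.ne']⟩
  refine (ho.measure_pos volume hne).trans_le (measure_mono fun x hx => ?_)
  have h0 : 0 < ‖x‖ := norm_pos_iff.2 hx.2
  have h1 : ‖x‖ < r := by simpa using hx.1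
  have : 1 < r / ‖x‖ := (one_lt_div h0).2 h1
  rw [Function.mem_support, circleLogKernel, ne_eq, Real.posLog_eq_zero_iff,
    abs_of_pos (zero_lt_one.trans this)]
  exact not_le.2 this

theorem circleAverage_log_norm_sub {r : ℝ} (hr : 0 < r) {z w : ℂ} (hzw : z ≠ w) :
    Real.circleAverage (fun x => Real.log ‖x - w‖) z r =
      Real.log ‖z - w‖ + circleLogKernel r (w - z) := by
  have h0 : 0 < ‖z - w‖ := norm_pos_iff.2 (sub_ne_zero.2 hzw)
  rw [circleAverage_log_norm_sub_const_eq_log_radius_add_posLog hr.ne', circleLogKernel,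
    norm_sub_rev w z]
  have h := Real.posLog_sub_posLog_inv (x := r⁻¹ * ‖z - w‖)
  rw [Real.log_mul (inv_ne_zero hr.ne') h0.ne', Real.log_inv, mul_inv, inv_inv,
    ← div_eq_mul_inv] at h
  linarith

/-- The sub-mean value inequality over circles, integrated against the radial kernel. -/
theorem mul_integral_circleLogKernel_le {v : ℂ → ℝ} {r : ℝ} (hr : 0 < r) {z : ℂ}
    (hv : Integrable fun x => v (z + x) * circleLogKernel r x)
    (hc : ∀ t, 0 < t → CircleIntegrable v z t)
    (hsub : ∀ t, 0 < t → v z ≤ Real.circleAverage v z t) :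
    v z * ∫ x, circleLogKernel r x ≤ ∫ x, v (z + x) * circleLogKernel r x := by
  rw [← integral_const_mul, ← sub_nonneg,
    ← integral_sub hv ((integrable_circleLogKernel hr).const_mul _),
    ← Complex.integral_comp_polarCoord_symm, polarCoord_target, Measure.volume_eq_prod]
  by_cases hi : IntegrableOn (fun p : ℝ × ℝ => p.1 •
      (v (z + Complex.polarCoord.symm p) * circleLogKernel r (Complex.polarCoord.symm p) -
        v z * circleLogKernel r (Complex.polarCoord.symm p)))
      (Set.Ioi 0 ×ˢ Set.Ioo (-Real.pi) Real.pi) (volume.prod volume)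
  · rw [setIntegral_prod _ hi]
    refine setIntegral_nonneg measurableSet_Ioi fun t (ht : 0 < t) => ?_
    have hpol : ∀ θ : ℝ, z + Complex.polarCoord.symm (t, θ) = circleMap z t θ := by
      intro θ
      rw [Complex.polarCoord_symm_apply, circleMap, Complex.exp_mul_I]
      simp
    have e : ∀ θ : ℝ, t • (v (z + Complex.polarCoord.symm (t, θ)) *
          circleLogKernel r (Complex.polarCoord.symm (t, θ)) -
        v z * circleLogKernel r (Complex.polarCoord.symm (t, θ))) =
        (t * Real.posLog (r / t)) * (v (circleMap z t θ) - v z) := by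
      intro θ
      rw [hpol, circleLogKernel, Complex.norm_polarCoord_symm, abs_of_pos ht, smul_eq_mul]
      ring
    simp_rw [e]
    rw [integral_const_mul]
    refine mul_nonneg (mul_nonneg ht.le Real.posLog_nonneg) ?_
    have h2 := hsub t ht
    have hper : Function.Periodic (fun θ => v (circleMap z t θ)) (2 * Real.pi) :=
      fun θ => by simp [periodic_circleMap z t θ]
    have hper' := hper.intervalIntegral_add_eq (-Real.pi) 0
    rw [zero_add, show -Real.pi + 2 * Real.pi = Real.pi by ring] at hper'
    have hci : IntervalIntegrable (fun θ => v (circleMap z t θ)) volume (-Real.pi) Real.pi := by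
      have := hper.intervalIntegrable (t := 0) (by positivity)
        (by simpa using! hc t ht) (-Real.pi) Real.pi
      exact this
    rw [← integral_Ioc_eq_integral_Ioo,
      ← intervalIntegral.integral_of_le (by linarith [Real.pi_pos]),
      intervalIntegral.integral_sub hci (by simp), hper', intervalIntegral.integral_const]
    rw [Real.circleAverage_def, smul_eq_mul] at h2
    have hpi := Real.pi_pos
    have h3 : 2 * Real.pi * v z ≤ ∫ θ in 0..2 * Real.pi, v (circleMap z t θ) := by
      calc _ ≤ 2 * Real.pi * ((2 * Real.pi)⁻¹ * ∫ θ in 0..2 * Real.pi, v (circleMap z t θ)) := by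
            gcongr
        _ = _ := by field_simp
    rw [smul_eq_mul]
    linarith
  -- a nonintegrable integrand has Bochner integral zero by convention
  · exact (integral_undef hi).ge

/-! ### Logarithmic potentials and averaging over circles -/

/-- The logarithmic potential `w ↦ ∫ log |z - w| dμ(z)`, with the Bochner integral; it is used only
at points `w` where the integrand is integrable. -/
noncomputable def logPotential (μ : Measure ℂ) (w : ℂ) : ℝ := ∫ z, Real.log ‖z - w‖ ∂μ

/-- The convolution `z ↦ ∫ g(w) log |z - w| dA(w)` with the logarithmic kernel. -/
noncomputable def convLog (g : ℂ → ℝ) (z : ℂ) : ℝ := ∫ w, g w * Real.log ‖z - w‖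

/-- The uniform probability measure on the circle with centre `z` and radius `r`. -/
noncomputable def circleMeasure (z : ℂ) (r : ℝ) : Measure ℂ :=
  ENNReal.ofReal (2 * Real.pi)⁻¹ •
    (volume.restrict (Set.Ioc 0 (2 * Real.pi))).map (circleMap z r)

instance isProbabilityMeasure_circleMeasure (z : ℂ) (r : ℝ) :
    IsProbabilityMeasure (circleMeasure z r) := by
  refine ⟨?_⟩
  have hpi := Real.two_pi_pos
  rw [circleMeasure, Measure.smul_apply, Measure.map_apply (measurable_circleMap z r) .univ]
  simp only [Set.preimage_univ, Measure.restrict_apply_univ, Real.volume_Ioc, sub_zero, smul_eq_mul]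
  rw [← ENNReal.ofReal_mul (by positivity), inv_mul_cancel₀ hpi.ne', ENNReal.ofReal_one]

theorem integral_circleMeasure {f : ℂ → ℝ} (hf : Measurable f) (z : ℂ) (r : ℝ) :
    ∫ a, f a ∂circleMeasure z r = Real.circleAverage f z r := by
  rw [circleMeasure, integral_smul_measure, integral_map (measurable_circleMap z r).aemeasurable
    hf.aestronglyMeasurable, Real.circleAverage_def,
    intervalIntegral.integral_of_le Real.two_pi_pos.le,
    ENNReal.toReal_ofReal (inv_nonneg.2 Real.two_pi_pos.le)]

theorem ae_circleMeasure_norm_sub (z : ℂ) {r : ℝ} (hr : 0 ≤ r) :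
    ∀ᵐ a ∂circleMeasure z r, ‖a - z‖ = r := by
  refine Measure.ae_smul_measure ?_ _
  rw [ae_map_iff (measurable_circleMap z r).aemeasurable
    (measurableSet_eq_fun (by fun_prop) (by fun_prop))]
  refine Filter.Eventually.of_forall fun θ => ?_
  simp [circleMap, abs_of_nonneg hr]

section Kernel

variable {g : ℂ → ℝ} {C s T : ℝ}

theorem abs_mul_log_le (hgC : ∀ w, |g w| ≤ C) (hgT : ∀ w, T ≤ ‖w‖ → g w = 0) {z : ℂ}
    (hz : ‖z‖ ≤ s) (w : ℂ) :
    |g w * Real.log ‖z - w‖| ≤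
      C * (Metric.ball 0 (s + T)).indicator (fun x : ℂ => |Real.log ‖x‖|) (z - w) := by
  have hC : 0 ≤ C := (abs_nonneg _).trans (hgC 0)
  rcases le_or_gt T ‖w‖ with hw | hw
  · rw [hgT w hw, zero_mul, abs_zero]
    exact mul_nonneg hC (Set.indicator_nonneg (fun _ _ => abs_nonneg _) _)
  · rw [Set.indicator_of_mem
      (by rw [mem_ball_zero_iff]; exact (norm_sub_le z w).trans_lt (by linarith)), abs_mul]
    exact mul_le_mul_of_nonneg_right (hgC w) (abs_nonneg _)

theorem integrable_indicator_abs_log (S : ℝ) :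
    Integrable ((Metric.ball 0 S).indicator fun x : ℂ => |Real.log ‖x‖|) :=
  (integrable_indicator_iff Metric.isOpen_ball.measurableSet).2 (integrableOn_log_norm_ball S).abs

theorem measurable_mul_log (hg : Measurable g) :
    Measurable fun p : ℂ × ℂ => g p.2 * Real.log ‖p.1 - p.2‖ :=
  (hg.comp measurable_snd).mul (Real.measurable_log.comp (by fun_prop))

theorem integrable_mul_log (hg : Measurable g) (hgC : ∀ w, |g w| ≤ C)
    (hgT : ∀ w, T ≤ ‖w‖ → g w = 0) (z : ℂ) : Integrable fun w => g w * Real.log ‖z - w‖ :=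
  (((integrable_indicator_abs_log (‖z‖ + T)).comp_sub_left z).const_mul C).mono'
    ((measurable_mul_log hg).comp measurable_prodMk_left).aestronglyMeasurable
    (Filter.Eventually.of_forall (abs_mul_log_le hgC hgT le_rfl))

theorem integral_abs_mul_log_le (hg : Measurable g) (hgC : ∀ w, |g w| ≤ C)
    (hgT : ∀ w, T ≤ ‖w‖ → g w = 0) {z : ℂ} (hz : ‖z‖ ≤ s) :
    ∫ w, |g w * Real.log ‖z - w‖| ≤
      C * ∫ x, (Metric.ball 0 (s + T)).indicator (fun x : ℂ => |Real.log ‖x‖|) x := by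
  rw [← integral_sub_left_eq_self (Set.indicator _ _) _ z, ← integral_const_mul]
  exact integral_mono (integrable_mul_log hg hgC hgT z).abs
    (((integrable_indicator_abs_log (s + T)).comp_sub_left z).const_mul C)
    (abs_mul_log_le hgC hgT hz)

theorem measurable_convLog (hg : Measurable g) : Measurable (convLog g) :=
  (measurable_mul_log hg).stronglyMeasurable.integral_prod_right.measurable

theorem abs_convLog_le (hg : Measurable g) (hgC : ∀ w, |g w| ≤ C)
    (hgT : ∀ w, T ≤ ‖w‖ → g w = 0) {z : ℂ} (hz : ‖z‖ ≤ s) :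
    |convLog g z| ≤
      C * ∫ x, (Metric.ball 0 (s + T)).indicator (fun x : ℂ => |Real.log ‖x‖|) x :=
  abs_integral_le_integral_abs.trans (integral_abs_mul_log_le hg hgC hgT hz)

variable {μ : Measure ℂ} [IsFiniteMeasure μ]

theorem integrable_prod_mul_log (hμ : ∀ᵐ z ∂μ, ‖z‖ ≤ s) (hg : Measurable g)
    (hgC : ∀ w, |g w| ≤ C) (hgT : ∀ w, T ≤ ‖w‖ → g w = 0) :
    Integrable (fun p : ℂ × ℂ => g p.2 * Real.log ‖p.1 - p.2‖) (μ.prod volume) := by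
  rw [integrable_prod_iff (measurable_mul_log hg).aestronglyMeasurable]
  refine ⟨Filter.Eventually.of_forall (integrable_mul_log hg hgC hgT), ?_⟩
  refine (integrable_const (C * ∫ x, (Metric.ball 0 (s + T)).indicator
    (fun x : ℂ => |Real.log ‖x‖|) x)).mono'
    (measurable_mul_log hg).norm.stronglyMeasurable.integral_prod_right.aestronglyMeasurable
    (hμ.mono fun z hz => ?_)
  rw [Real.norm_of_nonneg (integral_nonneg fun _ => norm_nonneg _)]
  exact integral_abs_mul_log_le hg hgC hgT hz

theorem integrable_mul_logPotential (hμ : ∀ᵐ z ∂μ, ‖z‖ ≤ s) (hg : Measurable g)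
    (hgC : ∀ w, |g w| ≤ C) (hgT : ∀ w, T ≤ ‖w‖ → g w = 0) :
    Integrable fun w => g w * logPotential μ w := by
  simpa only [integral_const_mul, logPotential] using!
    (integrable_prod_mul_log hμ hg hgC hgT).integral_prod_right

theorem integral_convLog (hμ : ∀ᵐ z ∂μ, ‖z‖ ≤ s) (hg : Measurable g)
    (hgC : ∀ w, |g w| ≤ C) (hgT : ∀ w, T ≤ ‖w‖ → g w = 0) :
    ∫ z, convLog g z ∂μ = ∫ w, g w * logPotential μ w := by
  unfold convLog
  rw [integral_integral_swap (integrable_prod_mul_log hμ hg hgC hgT)]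
  simp only [integral_const_mul, logPotential]

theorem convLog_add (z a : ℂ) : convLog g (z + a) = convLog (fun w => g (w + a)) z := by
  unfold convLog
  rw [← integral_add_right_eq_self _ a]
  simp only [add_sub_add_right_eq_sub]

theorem integral_convLog_add (hμ : ∀ᵐ z ∂μ, ‖z‖ ≤ s) (hg : Measurable g)
    (hgC : ∀ w, |g w| ≤ C) (hgT : ∀ w, T ≤ ‖w‖ → g w = 0) (a : ℂ) :
    Integrable (fun w => g (w + a) * logPotential μ w) ∧
      ∫ z, convLog g (z + a) ∂μ = ∫ w, g (w + a) * logPotential μ w := by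
  have h1 : Measurable fun w => g (w + a) := hg.comp (measurable_add_const a)
  have h3 : ∀ w, T + ‖a‖ ≤ ‖w‖ → g (w + a) = 0 := fun w hw => hgT _ (by
    have := norm_sub_le (w + a) a
    rw [add_sub_cancel_right] at this
    linarith)
  refine ⟨integrable_mul_logPotential hμ h1 (fun w => hgC (w + a)) h3, ?_⟩
  simp_rw [convLog_add]
  exact integral_convLog hμ h1 (fun w => hgC (w + a)) h3

theorem integrable_mul_circleLogKernel (hg : Measurable g) (hgC : ∀ w, |g w| ≤ C) {r : ℝ}
    (hr : 0 < r) (z : ℂ) : Integrable fun x => g (z + x) * circleLogKernel r x :=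
  (integrable_circleLogKernel hr).bdd_mul
    (hg.comp (measurable_const_add z)).aestronglyMeasurable
    (Filter.Eventually.of_forall fun x => hgC (z + x))

/-- Averaging a logarithmic convolution over a circle adds the convolution with
`circleLogKernel`. -/
theorem circleAverage_convLog (hg : Measurable g) (hgC : ∀ w, |g w| ≤ C)
    (hgT : ∀ w, T ≤ ‖w‖ → g w = 0) {r : ℝ} (hr : 0 < r) (z : ℂ) :
    Real.circleAverage (convLog g) z r =
      convLog g z + ∫ x, g (z + x) * circleLogKernel r x := by
  have hμ : ∀ᵐ a ∂circleMeasure z r, ‖a‖ ≤ ‖z‖ + r :=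
    (ae_circleMeasure_norm_sub z hr.le).mono fun a ha => by
      have := norm_add_le z (a - z)
      rwa [add_sub_cancel, ha] at this
  have h2 : Integrable fun w => g w * circleLogKernel r (w - z) := by
    have := (integrable_mul_circleLogKernel hg hgC hr z).comp_sub_right z
    simpa using this
  rw [← integral_circleMeasure (measurable_convLog hg), integral_convLog hμ hg hgC hgT,
    ← integral_sub_right_eq_self (fun x => g (z + x) * circleLogKernel r x) z, convLog]
  simp only [add_sub_cancel]
  rw [← integral_add (integrable_mul_log hg hgC hgT z) h2]
  refine integral_congr_ae ?_
  filter_upwards [Measure.ae_ne volume z] with w hw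
  have hm : Measurable fun a : ℂ => Real.log ‖a - w‖ := Real.measurable_log.comp (by fun_prop)
  rw [logPotential, integral_circleMeasure hm,
    circleAverage_log_norm_sub hr hw.symm, mul_add]

theorem circleAverage_eq_integral_add_circleMeasure {f : ℂ → ℝ} (hf : Measurable f) (z : ℂ)
    (r : ℝ) : Real.circleAverage f z r = ∫ a, f (z + a) ∂circleMeasure 0 r := by
  have hm : Measurable fun a => f (z + a) := hf.comp (measurable_const_add z)
  rw [integral_circleMeasure hm, ← Real.circleAverage_map_add_const]
  simp only [add_comm z]

/-- The convolution with `circleLogKernel`, integrated against `μ`, in terms of the potential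
of `μ`. -/
theorem integral_conv_circleLogKernel (hμ : ∀ᵐ z ∂μ, ‖z‖ ≤ s) (hg : Measurable g)
    (hgC : ∀ w, |g w| ≤ C) (hgT : ∀ w, T ≤ ‖w‖ → g w = 0) {r : ℝ} (hr : 0 < r) :
    Integrable (fun a => ∫ w, (g (w + a) - g w) * logPotential μ w) (circleMeasure 0 r) ∧
      ∫ z, (∫ x, g (z + x) * circleLogKernel r x) ∂μ =
        ∫ a, (∫ w, (g (w + a) - g w) * logPotential μ w) ∂circleMeasure 0 r := by
  set M := C * ∫ x, (Metric.ball 0 (s + r + T)).indicator (fun x : ℂ => |Real.log ‖x‖|) x with hM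
  have hVm := measurable_convLog hg
  have hσ : ∀ᵐ a ∂circleMeasure 0 r, ‖a‖ = r := by
    simpa using ae_circleMeasure_norm_sub 0 hr.le
  have hV : Integrable (convLog g) μ := by
    refine (integrable_const M).mono' hVm.aestronglyMeasurable (hμ.mono fun z hz => ?_)
    exact abs_convLog_le hg hgC hgT (hz.trans (by linarith))
  have hVp : Integrable (fun p : ℂ × ℂ => convLog g (p.1 + p.2)) (μ.prod (circleMeasure 0 r)) := by
    refine (integrable_const M).mono' (hVm.comp (by fun_prop)).aestronglyMeasurable ?_
    have h1 : ∀ᵐ p ∂μ.prod (circleMeasure 0 r), ‖p.1‖ ≤ s := Measure.quasiMeasurePreserving_fst.ae hμ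
    have h2 : ∀ᵐ p ∂μ.prod (circleMeasure 0 r), ‖p.2‖ = r := Measure.quasiMeasurePreserving_snd.ae hσ
    filter_upwards [h1, h2] with p hp1 hp2
    exact abs_convLog_le hg hgC hgT ((norm_add_le _ _).trans (by linarith))
  -- translation invariance moves the shift by `a` from the convolution to `g`
  have hint : ∀ a, (∫ z, convLog g (z + a) ∂μ) - ∫ z, convLog g z ∂μ =
      ∫ w, (g (w + a) - g w) * logPotential μ w := fun a => by
    obtain ⟨h1, h2⟩ := integral_convLog_add hμ hg hgC hgT a
    rw [h2, integral_convLog hμ hg hgC hgT, ← integral_sub h1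
      (integrable_mul_logPotential hμ hg hgC hgT)]
    simp only [sub_mul]
  simp_rw [← hint]
  refine ⟨hVp.integral_prod_right.sub (integrable_const _), ?_⟩
  calc ∫ z, (∫ x, g (z + x) * circleLogKernel r x) ∂μ
      = ∫ z, ((∫ a, convLog g (z + a) ∂circleMeasure 0 r) - convLog g z) ∂μ := by
        congr 1
        ext z
        rw [← circleAverage_eq_integral_add_circleMeasure hVm, circleAverage_convLog hg hgC hgT hr]
        ring
    _ = (∫ a, (∫ z, convLog g (z + a) ∂μ) ∂circleMeasure 0 r) - ∫ z, convLog g z ∂μ := by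
        rw [integral_sub hVp.integral_prod_left hV, integral_integral_swap hVp]
    _ = ∫ a, ((∫ z, convLog g (z + a) ∂μ) - ∫ z, convLog g z ∂μ) ∂circleMeasure 0 r := by
        rw [integral_sub hVp.integral_prod_right (integrable_const _)]
        simp
end Kernel

/-! ### Comparison of integrals of locally bounded subharmonic functions -/

theorem integrable_mul_circleLogKernel_of_locally_bounded {v : ℂ → ℝ} (hv : Measurable v) {r : ℝ}
    (hr : 0 < r) {z : ℂ} {C : ℝ} (hC : ∀ x, ‖x‖ < r → |v (z + x)| ≤ C) :
    Integrable (fun x => v (z + x) * circleLogKernel r x) ∧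
      |∫ x, v (z + x) * circleLogKernel r x| ≤ C * ∫ x, circleLogKernel r x := by
  have hb : ∀ x, ‖v (z + x) * circleLogKernel r x‖ ≤ C * circleLogKernel r x := fun x => by
    rcases lt_or_ge ‖x‖ r with hx | hx
    · rw [norm_mul, Real.norm_of_nonneg (circleLogKernel_nonneg r x)]
      exact mul_le_mul_of_nonneg_right (hC x hx) (circleLogKernel_nonneg r x)
    · simp [circleLogKernel_eq_zero hr hx]
  have hK := (integrable_circleLogKernel hr).const_mul C
  have hi := hK.mono' ((hv.comp (measurable_const_add z)).mul
    (measurable_circleLogKernel r)).aestronglyMeasurable (Filter.Eventually.of_forall hb)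
  refine ⟨hi, ?_⟩
  rw [← integral_const_mul]
  exact norm_integral_le_of_norm_le hK (Filter.Eventually.of_forall hb)

/-- If the potential of `ω` dominates that of `δ`, with equality off a disc, then the convolution
of a subharmonic function with `circleLogKernel` has the larger integral against `ω`. -/
theorem integral_conv_circleLogKernel_le {δ ω : Measure ℂ} [IsFiniteMeasure δ] [IsFiniteMeasure ω]
    {s : ℝ} (hδ : ∀ᵐ z ∂δ, ‖z‖ ≤ s) (hω : ∀ᵐ z ∂ω, ‖z‖ ≤ s)
    (hin : ∀ᵐ w, ‖w‖ ≤ s → logPotential δ w ≤ logPotential ω w)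
    (hout : ∀ w, s < ‖w‖ → logPotential δ w = logPotential ω w)
    {v : ℂ → ℝ} (hv : Measurable v) (hbd : ∀ S : ℝ, ∃ C, ∀ z, ‖z‖ ≤ S → |v z| ≤ C)
    {r : ℝ} (hr : 0 < r) (hr1 : r ≤ 1) (hsub : ∀ z, v z ≤ Real.circleAverage v z r) :
    ∫ z, (∫ x, v (z + x) * circleLogKernel r x) ∂δ ≤
      ∫ z, (∫ x, v (z + x) * circleLogKernel r x) ∂ω := by
  obtain ⟨C, hC⟩ := hbd (s + 2)
  -- only the values of `v` near the disc `‖z‖ ≤ s` matter, so `v` is cut off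
  set U : ℂ → ℝ := (Metric.ball 0 (s + 2)).indicator v with hU
  have hUv : ∀ z x : ℂ, ‖z‖ ≤ s → ‖x‖ ≤ r → U (z + x) = v (z + x) := fun z x hz hx =>
    Set.indicator_of_mem (by
      rw [mem_ball_zero_iff]; exact (norm_add_le z x).trans_lt (by linarith)) _
  have hUm : Measurable U := hv.indicator Metric.isOpen_ball.measurableSet
  have hUC : ∀ w, |U w| ≤ |C| := fun w => by
    by_cases hw : w ∈ Metric.ball (0 : ℂ) (s + 2)
    · rw [hU, Set.indicator_of_mem hw]
      exact (hC w (mem_ball_zero_iff.1 hw).le).trans (le_abs_self C)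
    · rw [hU, Set.indicator_of_notMem hw, abs_zero]
      exact abs_nonneg C
  have hUT : ∀ w, s + 2 ≤ ‖w‖ → U w = 0 := fun w hw =>
    Set.indicator_of_notMem (by rw [mem_ball_zero_iff]; exact not_lt.2 hw) _
  have hconv : ∀ z : ℂ, ‖z‖ ≤ s → ∫ x, v (z + x) * circleLogKernel r x =
      ∫ x, U (z + x) * circleLogKernel r x := fun z hz => by
    congr 1
    ext x
    rcases lt_or_ge ‖x‖ r with hx | hx
    · rw [hUv z x hz hx.le]
    · rw [circleLogKernel_eq_zero hr hx, mul_zero, mul_zero]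
  rw [integral_congr_ae (hδ.mono hconv), integral_congr_ae (hω.mono hconv)]
  obtain ⟨hδi, hδe⟩ := integral_conv_circleLogKernel hδ hUm hUC hUT hr
  obtain ⟨hωi, hωe⟩ := integral_conv_circleLogKernel hω hUm hUC hUT hr
  rw [hδe, hωe, ← sub_nonneg, ← integral_sub hωi hδi]
  set B : ℂ → ℝ := (Metric.closedBall (0 : ℂ) s).indicator fun _ => 1 with hB
  have hB1 : ∀ w, ‖w‖ ≤ s → B w = 1 := fun w hw =>
    Set.indicator_of_mem (mem_closedBall_zero_iff.2 hw) _
  have hB0 : ∀ w, s < ‖w‖ → B w = 0 := fun w hw =>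
    Set.indicator_of_notMem (by rw [mem_closedBall_zero_iff]; exact not_le.2 hw) _
  have hBm : Measurable B := measurable_const.indicator Metric.isClosed_closedBall.measurableSet
  have hBC : ∀ w, |B w| ≤ 1 := fun w => by
    rcases le_or_gt ‖w‖ s with hw | hw
    · rw [hB1 w hw, abs_one]
    · rw [hB0 w hw, abs_zero]; exact zero_le_one
  have hBT : ∀ w, s + 1 ≤ ‖w‖ → B w = 0 := fun w hw => hB0 w (by linarith)
  -- `Q` is the difference of the potentials; the cut-off `B` changes nothing, as that difference
  -- vanishes off the disc, but makes integrability visible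
  set Q : ℂ → ℝ := fun w => B w * logPotential ω w - B w * logPotential δ w with hQ
  have hQi : Integrable Q := (integrable_mul_logPotential hω hBm hBC hBT).sub
    (integrable_mul_logPotential hδ hBm hBC hBT)
  have hdiff : ∀ a, (∫ w, (U (w + a) - U w) * logPotential ω w) -
      ∫ w, (U (w + a) - U w) * logPotential δ w = ∫ w, (U (w + a) - U w) * Q w := by
    intro a
    have hsm : ∀ {μ : Measure ℂ} [IsFiniteMeasure μ], (∀ᵐ z ∂μ, ‖z‖ ≤ s) →
        Integrable fun w => (U (w + a) - U w) * logPotential μ w := fun hμ => by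
      simp only [sub_mul]
      exact (integral_convLog_add hμ hUm hUC hUT a).1.sub
        (integrable_mul_logPotential hμ hUm hUC hUT)
    rw [← integral_sub (hsm hω) (hsm hδ)]
    congr 1
    ext w
    rcases le_or_gt ‖w‖ s with hw | hw
    · simp only [hQ, hB1 w hw]; ring
    · simp only [hQ, hB0 w hw, hout w hw]; ring
  simp_rw [hdiff]
  have hprod : Integrable (fun p : ℂ × ℂ => (U (p.2 + p.1) - U p.2) * Q p.2)
      ((circleMeasure 0 r).prod volume) := by
    refine (hQi.comp_snd _).bdd_mul (c := |C| + |C|) ?_ (Filter.Eventually.of_forall fun p => ?_)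
    · exact ((hUm.comp (by fun_prop)).sub (hUm.comp measurable_snd)).aestronglyMeasurable
    · exact (norm_sub_le _ _).trans (add_le_add (hUC _) (hUC _))
  rw [integral_integral_swap hprod]
  refine integral_nonneg_of_ae (hin.mono fun w hw => ?_)
  simp only [Pi.zero_apply]
  rcases le_or_gt ‖w‖ s with hws | hws
  · rw [integral_mul_const]
    refine mul_nonneg ?_ ?_
    · have hUi : Integrable (fun a => U (w + a)) (circleMeasure 0 r) :=
        (integrable_const |C|).mono' (hUm.comp (measurable_const_add w)).aestronglyMeasurable
          (Filter.Eventually.of_forall fun a => hUC _)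
      have hσ : ∀ᵐ a ∂circleMeasure 0 r, U (w + a) = v (w + a) :=
        (ae_circleMeasure_norm_sub 0 hr.le).mono fun a ha =>
          hUv w a hws (by rw [sub_zero] at ha; exact ha.le)
      rw [integral_sub hUi (integrable_const _), integral_congr_ae hσ,
        ← circleAverage_eq_integral_add_circleMeasure hv]
      have h0 : U w = v w := by simpa using hUv w 0 hws (by simpa using hr.le)
      simpa [h0] using hsub w
    · simpa only [hQ, hB1 w hws, one_mul, sub_nonneg] using hw hws
  · simp [hQ, hB0 w hws]

/-- A locally bounded subharmonic function has the larger integral against the measure with the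
larger potential, if the potentials agree off a disc. -/
theorem integral_le_of_logPotential_le {δ ω : Measure ℂ} [IsFiniteMeasure δ] [IsFiniteMeasure ω]
    {s : ℝ} (hδ : ∀ᵐ z ∂δ, ‖z‖ ≤ s) (hω : ∀ᵐ z ∂ω, ‖z‖ ≤ s)
    (hin : ∀ᵐ w, ‖w‖ ≤ s → logPotential δ w ≤ logPotential ω w)
    (hout : ∀ w, s < ‖w‖ → logPotential δ w = logPotential ω w)
    {v : ℂ → ℝ} (hv : UpperSemicontinuous v) (hbd : ∀ S : ℝ, ∃ C, ∀ z, ‖z‖ ≤ S → |v z| ≤ C)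
    (hsub : ∀ z r, 0 < r → v z ≤ Real.circleAverage v z r) :
    ∫ z, v z ∂δ ≤ ∫ z, v z ∂ω := by
  have hvm : Measurable v := hv.measurable
  have hci : ∀ z t, 0 < t → CircleIntegrable v z t := by
    intro z t ht
    obtain ⟨C, hC⟩ := hbd (‖z‖ + t)
    rw [CircleIntegrable, intervalIntegrable_iff]
    refine Measure.integrableOn_of_bounded (M := C) (by simp [ENNReal.mul_eq_top])
      (hvm.comp (measurable_circleMap z t)).aestronglyMeasurable
      (Filter.Eventually.of_forall fun θ => hC _ ?_)
    refine (norm_add_le _ _).trans (add_le_add le_rfl ?_)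
    simp [abs_of_pos ht]
  set r : ℕ → ℝ := fun n => 1 / ((n : ℝ) + 1) with hr
  have hr0 : ∀ n, 0 < r n := fun n => by positivity
  have hr1 : ∀ n, r n ≤ 1 := fun n => by
    rw [hr]
    exact (div_le_one (by positivity)).2 (by linarith [(n.cast_nonneg : (0 : ℝ) ≤ n)])
  have hrt : Filter.Tendsto r Filter.atTop (nhds 0) := tendsto_one_div_add_atTop_nhds_zero_nat
  set c : ℕ → ℝ := fun n => ∫ x, circleLogKernel (r n) x with hc
  have hc0 : ∀ n, 0 < c n := fun n => integral_circleLogKernel_pos (hr0 n)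
  set A : ℕ → ℂ → ℝ := fun n z => (∫ x, v (z + x) * circleLogKernel (r n) x) / c n with hA
  have hbdx : ∀ z, ∃ C, ∀ n x, ‖x‖ < r n → |v (z + x)| ≤ C := fun z => by
    obtain ⟨C, hC⟩ := hbd (‖z‖ + 1)
    exact ⟨C, fun n x hx => hC _ ((norm_add_le z x).trans (by linarith [hr1 n]))⟩
  have hi : ∀ n z, Integrable fun x => v (z + x) * circleLogKernel (r n) x := fun n z =>
    (integrable_mul_circleLogKernel_of_locally_bounded hvm (hr0 n)
      ((hbdx z).choose_spec n)).1
  have hlow : ∀ n z, v z ≤ A n z := fun n z =>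
    (le_div_iff₀ (hc0 n)).2 (mul_integral_circleLogKernel_le (hr0 n) (hi n z)
      (hci z) (hsub z))
  -- the averages tend to `v`: from above by the sub-mean value inequality, and their upper limit
  -- is at most `v` by upper semicontinuity
  have htend : ∀ z, Filter.Tendsto (fun n => A n z) Filter.atTop (nhds (v z)) := by
    intro z
    refine tendsto_order.2 ⟨fun a ha => Filter.Eventually.of_forall fun n =>
      ha.trans_le (hlow n z), fun a ha => ?_⟩
    obtain ⟨b, hb, hba⟩ := exists_between ha
    obtain ⟨ρ, hρ, hρb⟩ := Metric.eventually_nhds_iff.1 (hv z b hb)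
    filter_upwards [(tendsto_order.1 hrt).2 ρ hρ] with n hn
    refine lt_of_le_of_lt ((div_le_iff₀ (hc0 n)).2 ?_) hba
    rw [hc, ← integral_const_mul]
    refine integral_mono (hi n z) ((integrable_circleLogKernel (hr0 n)).const_mul b) fun x => ?_
    rcases lt_or_ge ‖x‖ (r n) with hx | hx
    · exact mul_le_mul_of_nonneg_right (hρb (by simpa [dist_eq_norm] using hx.trans hn)).le
        (circleLogKernel_nonneg _ _)
    · simp [circleLogKernel_eq_zero (hr0 n) hx]
  have hAm : ∀ n, Measurable (A n) := fun n => by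
    have : Measurable fun p : ℂ × ℂ => v (p.1 + p.2) * circleLogKernel (r n) p.2 :=
      (hvm.comp (by fun_prop)).mul ((measurable_circleLogKernel _).comp measurable_snd)
    exact this.stronglyMeasurable.integral_prod_right.measurable.div_const _
  have hlim : ∀ {μ : Measure ℂ} [IsFiniteMeasure μ], (∀ᵐ z ∂μ, ‖z‖ ≤ s) →
      Filter.Tendsto (fun n => ∫ z, A n z ∂μ) Filter.atTop (nhds (∫ z, v z ∂μ)) := fun hμ => by
    obtain ⟨C, hC⟩ := hbd (s + 1)
    refine tendsto_integral_of_dominated_convergence (fun _ => C)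
      (fun n => (hAm n).aestronglyMeasurable) (integrable_const C)
      (fun n => hμ.mono fun z hz => ?_) (Filter.Eventually.of_forall htend)
    have := (integrable_mul_circleLogKernel_of_locally_bounded hvm (hr0 n) (z := z) (C := C)
      fun x hx => hC _ ((norm_add_le z x).trans (by linarith [hr1 n]))).2
    rw [Real.norm_eq_abs, abs_div, abs_of_pos (hc0 n)]
    exact (div_le_iff₀ (hc0 n)).2 this
  refine le_of_tendsto_of_tendsto' (hlim hδ) (hlim hω) fun n => ?_
  simp only [hA, integral_div]
  exact div_le_div_of_nonneg_right (integral_conv_circleLogKernel_le hδ hω hin hout hvm hbd (hr0 n)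
    (hr1 n) fun z => hsub z _ (hr0 n)) (hc0 n).le

/-! ### Truncation of subharmonic functions -/

/-- The truncation from below `max u (-N)` of an extended real function, as a real function. -/
noncomputable def truncBelow (u : ℂ → EReal) (N : ℕ) (z : ℂ) : ℝ :=
  (max (u z) ((-(N : ℝ) : ℝ) : EReal)).toReal

theorem coe_truncBelow {u : ℂ → EReal} (hu : ∀ z, u z < ⊤) (N : ℕ) (z : ℂ) :
    (truncBelow u N z : EReal) = max (u z) ((-(N : ℝ) : ℝ) : EReal) :=
  EReal.coe_toReal (max_lt (hu z) (EReal.coe_lt_top _)).ne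
    ((EReal.bot_lt_coe _).trans_le (le_max_right _ _)).ne'

theorem IsSubharmonic.upperSemicontinuous_truncBelow {u : ℂ → EReal} (hu : IsSubharmonic u)
    (N : ℕ) : UpperSemicontinuous (truncBelow u N) := by
  have h := hu.2.1.sup (upperSemicontinuous_const (z := ((-(N : ℝ) : ℝ) : EReal)))
  intro z y hy
  have := h z (y : EReal) (by
    change max (u z) _ < _
    rwa [← coe_truncBelow hu.1, EReal.coe_lt_coe_iff])
  refine this.mono fun x hx => ?_
  change max (u x) _ < _ at hx
  rwa [← coe_truncBelow hu.1, EReal.coe_lt_coe_iff] at hx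

theorem IsSubharmonic.exists_abs_truncBelow_le {u : ℂ → EReal} (hu : IsSubharmonic u) (N : ℕ)
    (S : ℝ) : ∃ C, ∀ z, ‖z‖ ≤ S → |truncBelow u N z| ≤ C := by
  have hne : (Metric.closedBall (0 : ℂ) |S|).Nonempty := ⟨0, by simp⟩
  obtain ⟨z₀, -, hz₀⟩ := (hu.upperSemicontinuous_truncBelow N).upperSemicontinuousOn
    (Metric.closedBall (0 : ℂ) |S|) |>.exists_isMaxOn hne (isCompact_closedBall 0 |S|)
  refine ⟨max N (truncBelow u N z₀), fun z hz => abs_le.2 ⟨?_, ?_⟩⟩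
  · have h1 : -(N : ℝ) ≤ truncBelow u N z := by
      rw [← EReal.coe_le_coe_iff, coe_truncBelow hu.1]
      exact le_max_right _ _
    linarith [le_max_left (N : ℝ) (truncBelow u N z₀)]
  · exact (hz₀ (mem_closedBall_zero_iff.2 (hz.trans (le_abs_self S)))).trans (le_max_right _ _)

theorem IsSubharmonic.integrable_truncBelow {u : ℂ → EReal} (hu : IsSubharmonic u) (N : ℕ)
    {μ : Measure ℂ} [IsFiniteMeasure μ] {s : ℝ} (hμ : ∀ᵐ z ∂μ, ‖z‖ ≤ s) :
    Integrable (truncBelow u N) μ := by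
  obtain ⟨C, hC⟩ := hu.exists_abs_truncBelow_le N s
  exact (integrable_const C).mono'
    (hu.upperSemicontinuous_truncBelow N).measurable.aestronglyMeasurable
    (hμ.mono fun z hz => hC z hz)

theorem IsSubharmonic.truncBelow_le_circleAverage {u : ℂ → EReal} (hu : IsSubharmonic u) (N : ℕ)
    (z : ℂ) (r : ℝ) (hr : 0 < r) :
    truncBelow u N z ≤ Real.circleAverage (truncBelow u N) z r := by
  have hvm := (hu.upperSemicontinuous_truncBelow N).measurable
  have hi : Integrable (truncBelow u N) (circleMeasure z r) :=
    hu.integrable_truncBelow N (s := ‖z‖ + r)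
      ((ae_circleMeasure_norm_sub z hr.le).mono fun a ha => by
        have := norm_add_le z (a - z)
        rwa [add_sub_cancel, ha] at this)
  have hi' : Integrable (fun θ => truncBelow u N (circleMap z r θ))
      (ENNReal.ofReal (2 * Real.pi)⁻¹ • volume.restrict (Set.Ioc 0 (2 * Real.pi))) := by
    rw [circleMeasure, ← Measure.map_smul,
      integrable_map_measure hvm.aestronglyMeasurable (measurable_circleMap z r).aemeasurable] at hi
    exact hi
  have hmean : circleMean (fun x => (truncBelow u N x : EReal)) z r =
      ((Real.circleAverage (truncBelow u N) z r : ℝ) : EReal) := by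
    rw [circleMean, extIntegral_coe hi', ← integral_circleMeasure hvm, circleMeasure,
      ← Measure.map_smul, integral_map (measurable_circleMap z r).aemeasurable
      hvm.aestronglyMeasurable]
  rw [← EReal.coe_le_coe_iff, coe_truncBelow hu.1, max_le_iff]
  constructor
  · refine (hu.2.2 z r hr).trans (hmean ▸ extIntegral_mono_ae (Filter.Eventually.of_forall ?_))
    intro θ
    simp only [coe_truncBelow hu.1]
    exact le_max_left _ _
  · rw [EReal.coe_le_coe_iff, ← integral_circleMeasure hvm]
    have h1 : ∀ x, -(N : ℝ) ≤ truncBelow u N x := fun x => by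
      rw [← EReal.coe_le_coe_iff, coe_truncBelow hu.1]
      exact le_max_right _ _
    simpa using integral_mono (μ := circleMeasure z r) (integrable_const _) hi h1

theorem IsSubharmonic.lintegral_toENNReal_ne_top {u : ℂ → EReal} (hu : IsSubharmonic u)
    {μ : Measure ℂ} [IsFiniteMeasure μ] {s : ℝ} (hμ : ∀ᵐ z ∂μ, ‖z‖ ≤ s) :
    ∫⁻ z, (u z).toENNReal ∂μ ≠ ⊤ := by
  refine ne_top_of_le_ne_top (hu.integrable_truncBelow 0 hμ).lintegral_lt_top.ne
    (lintegral_mono fun z => ?_)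
  rw [← EReal.real_coe_toENNReal, coe_truncBelow hu.1]
  exact EReal.toENNReal_le_toENNReal (le_max_left _ _)

theorem IsSubharmonic.hasExtIntegral {u : ℂ → EReal} (hu : IsSubharmonic u)
    {μ : Measure ℂ} [IsFiniteMeasure μ] {s : ℝ} (hμ : ∀ᵐ z ∂μ, ‖z‖ ≤ s) : HasExtIntegral μ u :=
  ⟨hu.2.1.measurable.aemeasurable, Or.inl (hu.lintegral_toENNReal_ne_top hμ)⟩

theorem IsSubharmonic.tendsto_extIntegral_truncBelow {u : ℂ → EReal} (hu : IsSubharmonic u)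
    {μ : Measure ℂ} [IsFiniteMeasure μ] {s : ℝ} (hμ : ∀ᵐ z ∂μ, ‖z‖ ≤ s) :
    Filter.Tendsto (fun N => extIntegral μ fun z => (truncBelow u N z : EReal)) Filter.atTop
      (nhds (extIntegral μ u)) := by
  -- truncation from below at `-N ≤ 0` does not affect the positive part
  have hpos : ∀ N z, ((truncBelow u N z : ℝ) : EReal).toENNReal = (u z).toENNReal := by
    intro N z
    rw [coe_truncBelow hu.1]
    have h0 : ((-(N : ℝ) : ℝ) : EReal) ≤ 0 := by
      rw [← EReal.coe_zero, EReal.coe_le_coe_iff]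
      simp
    rcases le_total (u z) ((-(N : ℝ) : ℝ) : EReal) with h | h
    · rw [max_eq_right h, EReal.toENNReal_of_nonpos h0, EReal.toENNReal_of_nonpos (h.trans h0)]
    · rw [max_eq_left h]
  have hneg : Filter.Tendsto (fun N => ∫⁻ z, (-(truncBelow u N z : EReal)).toENNReal ∂μ)
      Filter.atTop (nhds (∫⁻ z, (-u z).toENNReal ∂μ)) := by
    refine lintegral_tendsto_of_tendsto_of_monotone (fun N => ?_)
      (Filter.Eventually.of_forall fun z => ?_) (Filter.Eventually.of_forall fun z => ?_)
    · exact (hu.upperSemicontinuous_truncBelow N).measurable.coe_real_ereal.neg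
        |>.ereal_toENNReal.aemeasurable
    · intro N M hNM
      refine EReal.toENNReal_le_toENNReal (EReal.neg_le_neg_iff.2 ?_)
      rw [coe_truncBelow hu.1, coe_truncBelow hu.1]
      refine max_le_max le_rfl (EReal.coe_le_coe_iff.2 (neg_le_neg ?_))
      exact_mod_cast hNM
    · refine (EReal.continuous_toENNReal.tendsto _).comp
        ((continuous_neg.tendsto _).comp ?_)
      simp only [coe_truncBelow hu.1]
      have h1 : Filter.Tendsto (fun N : ℕ => ((-(N : ℝ) : ℝ) : EReal)) Filter.atTop (nhds ⊥) :=
        EReal.tendsto_coe_atBot.comp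
          (Filter.tendsto_neg_atTop_atBot.comp tendsto_natCast_atTop_atTop)
      simpa using (tendsto_const_nhds (x := u z)).max h1
  unfold extIntegral
  simp only [hpos]
  have hfin := hu.lintegral_toENNReal_ne_top hμ
  simp only [sub_eq_add_neg]
  refine (EReal.continuousAt_add (p := (((∫⁻ z, (u z).toENNReal ∂μ : ENNReal) : EReal),
    -((∫⁻ z, (-u z).toENNReal ∂μ : ENNReal) : EReal))) (Or.inl ?_) (Or.inl ?_)).tendsto.comp
    (tendsto_const_nhds.prodMk_nhds ((continuous_neg.tendsto _).comp
      (EReal.tendsto_coe_ennreal.2 hneg)))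
  · simpa using hfin
  · simp

/-! ### Balayage with respect to subharmonic functions -/

/-- At almost every point the extended integral of `log |z - w|` is the real potential. -/
theorem ae_extIntegral_log_eq {μ : Measure ℂ} [IsFiniteMeasure μ] {s : ℝ}
    (hμ : ∀ᵐ z ∂μ, ‖z‖ ≤ s) :
    ∀ᵐ w, ‖w‖ ≤ s →
      extIntegral μ (fun z => ENNReal.log ‖z - w‖ₑ) = (logPotential μ w : EReal) := by
  have hBm : Measurable ((Metric.closedBall (0 : ℂ) s).indicator fun _ => (1 : ℝ)) :=
    measurable_const.indicator Metric.isClosed_closedBall.measurableSet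
  have h1 := (integrable_prod_mul_log (C := 1) (T := s + 1) hμ hBm
    (fun w => by
      by_cases hw : w ∈ Metric.closedBall (0 : ℂ) s
      · simp [Set.indicator_of_mem hw]
      · simp [Set.indicator_of_notMem hw])
    (fun w hw => Set.indicator_of_notMem
      (by rw [mem_closedBall_zero_iff]; linarith) _)).prod_left_ae
  -- almost no `w` is an atom of `μ`, so the value of the logarithm at `0` is immaterial
  have h2 : ∀ᵐ w : ℂ, ∀ᵐ z ∂μ, z ≠ w := by
    refine (Measure.ae_ae_comm (μ := μ) (ν := volume) (p := fun z w => z ≠ w) ?_).1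
      (Filter.Eventually.of_forall fun z => ?_)
    · exact (measurableSet_eq_fun measurable_fst measurable_snd).compl
    · exact (Measure.ae_ne volume z).mono fun w hw => hw.symm
  filter_upwards [h1, h2] with w hw1 hw2 hws
  rw [Set.indicator_of_mem (mem_closedBall_zero_iff.2 hws)] at hw1
  simp only [one_mul] at hw1
  rw [logPotential, ← extIntegral_coe hw1]
  refine extIntegral_congr_ae (hw2.mono fun z hz => ?_)
  simp only
  rw [← ofReal_norm, ENNReal.log_ofReal_of_pos (norm_pos_iff.2 (sub_ne_zero.2 hz))]

theorem IsBalayage.sbh_of_lnmon {δ ω : Measure ℂ} [IsFiniteMeasure δ] [IsFiniteMeasure ω] {s : ℝ}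
    (hs : 0 ≤ s) (hδ : ∀ᵐ z ∂δ, ‖z‖ ≤ s) (hω : ∀ᵐ z ∂ω, ‖z‖ ≤ s)
    (hb : IsBalayage (lnmonClass ⊤) δ ω) : IsBalayage sbhClass δ ω := by
  have hmon : IsBalayage (monClass ⊤) δ ω := fun h hh => hb h (Or.inr hh)
  have hout : ∀ w, s < ‖w‖ → logPotential δ w = logPotential ω w := fun w hw =>
    integral_log_eq_of_moment_eq hs hδ hω (moments_eq_of_isBalayage_top hδ hmon) hw
  have hin : ∀ᵐ w, ‖w‖ ≤ s → logPotential δ w ≤ logPotential ω w := by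
    filter_upwards [ae_extIntegral_log_eq hδ, ae_extIntegral_log_eq hω] with w h1 h2 hw
    have := (hb _ (Or.inl ⟨w, rfl⟩)).2.2
    rwa [h1 hw, h2 hw, EReal.coe_le_coe_iff] at this
  intro u hu
  have hu : IsSubharmonic u := hu
  refine ⟨hu.hasExtIntegral hδ, hu.hasExtIntegral hω,
    ge_of_tendsto' (hu.tendsto_extIntegral_truncBelow hω) fun N => ?_⟩
  calc extIntegral δ u ≤ extIntegral δ fun z => (truncBelow u N z : EReal) :=
        extIntegral_mono_ae (Filter.Eventually.of_forall fun z => by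
          simp only [coe_truncBelow hu.1]
          exact le_max_left _ _)
    _ ≤ extIntegral ω fun z => (truncBelow u N z : EReal) := by
        rw [extIntegral_coe (hu.integrable_truncBelow N hδ),
          extIntegral_coe (hu.integrable_truncBelow N hω), EReal.coe_le_coe_iff]
        exact integral_le_of_logPotential_le hδ hω hin hout (hu.upperSemicontinuous_truncBelow N)
          (hu.exists_abs_truncBelow_le N) (hu.truncBelow_le_circleAverage N)

theorem mainTheorem7 (p : ℝ) (hp : 0 ≤ p) (δ ω : Measure ℂ)
    (hδ_pos : 0 < δ Set.univ) (hδ_fin : δ Set.univ < ⊤)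
    (hω_pos : 0 < ω Set.univ) (hω_fin : ω Set.univ < ⊤) :
    -- balayage for degrees below one
    (p < 1 → (IsBalayage (monClass p) δ ω ↔ ω Set.univ = δ Set.univ)) ∧
    -- balayage, moments and polynomials
    ((Integrable (fun z : ℂ => z ^ ⌊p⌋₊) δ ∨ Integrable (fun z : ℂ => z ^ ⌊p⌋₊) ω) →
      List.TFAE [
        IsBalayage (monClass p) δ ω,
        ∀ k : ℕ, (k : ℝ) ≤ p →
          Integrable (fun z : ℂ => z ^ k) δ ∧ Integrable (fun z : ℂ => z ^ k) ω ∧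
            ∫ z : ℂ, z ^ k ∂δ = ∫ z : ℂ, z ^ k ∂ω,
        ∀ P : Polynomial ℂ, (P.natDegree : ℝ) ≤ p →
          Integrable (fun z : ℂ => P.eval z) δ ∧ Integrable (fun z : ℂ => P.eval z) ω ∧
            ∫ z : ℂ, P.eval z ∂δ = ∫ z : ℂ, P.eval z ∂ω]) ∧
    -- existence of the integrals
    (starN ω 1 ⊤ (fun t => t ^ ⌊p⌋₊) < ⊤ →
      ∀ h ∈ lnmonClass p, HasExtIntegral ω h ∧ extIntegral ω h < ⊤) ∧
    -- compactly supported measures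
    (IsCompact δ.support → IsCompact ω.support →
      (IsBalayage (monClass ⊤) δ ω → IsBalayage harClass δ ω) ∧
      (IsBalayage (lnmonClass ⊤) δ ω → IsBalayage sbhClass δ ω)) := by
  have : IsFiniteMeasure δ := ⟨hδ_fin⟩
  have : IsFiniteMeasure ω := ⟨hω_fin⟩
  refine ⟨fun hp1 => isBalayage_monClass_iff_measure_univ_eq hp hp1, balayage_moments_polynomials_tfae,
    fun h u hu => hasExtIntegral_lnmonClass h hu, fun hδ hω => ?_⟩
  obtain ⟨s, hs, hδs, hωs⟩ := exists_ae_norm_le_of_isCompact_support hδ hω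
  exact ⟨IsBalayage.har_of_mon hs hδs hωs, IsBalayage.sbh_of_lnmon hs hδs hωs⟩
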